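/- Let $\sigma$ be the arc length measure on the unit circle $S^1\subset\mathbb{R}^2$. For $f\in L^2(S^1)=L^2(S^1,\sigma)$ (complex valued) put $\widehat{f\sigma}(\xi)=\int_{S^1}e^{-i\xi\cdot x}f(x)\,d\sigma(x)$ for $\xi\in\mathbb{R}^2$; write $\|\cdot\|_2$ for the norm of $L^2(S^1)$ and $\|\cdot\|_6$ for the norm of $L^6(\mathbb{R}^2)$, and let $\mathcal{R}=\sup\{\|\widehat{f\sigma}\|_6:\ f\in L^2(S^1),\ \|f\|_2=1\}$. For $z\in S^1$ and $0<r\le 1$, the cap $\mathcal{C}(z,r)$ is the set of all $y\in S^1$ with $y\cdot z>0$ and $|\pi_{H_z}(y)|<r$, where $\pi_{H_z}$ is the orthogonal projection onto the orthogonal complement $H_z$ of $z$; write $|\mathcal{C}|=\sigma(\mathcal{C})$ and let $\chi_{\mathcal{C}}$ be the indicator function of $\mathcal{C}$. For every $\delta>0$ there exist $C_\delta<\infty$ and $\eta_\delta>0$ with the following property. If $f\in L^2(S^1)$ satisfies $\|\widehat{f\sigma}\|_6\ge\delta\mathcal{R}\|f\|_2$, then there exist a decomposition $f=g+h$ with $g,h\in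 L^2(S^1)$ and a cap $\mathcal{C}=\mathcal{C}(z,r)$, $0<r\le1$, such that 1. $|g|\le|f|$ and $|h|\le|f|$; 2. $g$ and $h$ have disjoint supports, that is, the sets $\{g\neq0\}$ and $\{h\neq0\}$ are disjoint; 3. $|g(x)|\le C_\delta\|f\|_2\,|\mathcal{C}|^{-1/2}\chi_{\mathcal{C}}(x)$ for all $x\in S^1$; 4. $\|g\|_2\ge\eta_\delta\|f\|_2$. If $f\ge0$ almost everywhere, then $g$ and $h$ can moreover be chosen such that $g,h\ge0$ almost everywhere. The constants can be chosen such that $C_\delta^{-1}$ and $\eta_\delta$ are, as functions of $\delta>0$, positive constant multiples of powers of $\delta$ with exponents that are nonnegative integers: there are absolute constants $\kappa,\kappa'>0$ and integers $a,b\ge0$ with $C_\delta^{-1}=\kappa\delta^{a}$ and $\eta_\delta=\kappa'\delta^{b}$ for all $\delta>0$. -/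

import Mathlib

open MeasureTheory Metric
open scoped ENNReal ComplexOrder

noncomputable section

namespace CircleExtension

/-- The Euclidean plane. -/
abbrev Plane : Type := EuclideanSpace ℝ (Fin 2)

/-- The unit circle in the plane. -/
abbrev S1 : Type := sphere (0 : Plane) 1

/-- The (arc length) surface measure on the unit circle, of total mass `2π`. -/
def σ : Measure S1 := (volume : Measure Plane).toSphere

/-- The adjoint restriction operator: `ξ ↦ (fσ)^(ξ) = ∫ e^{-i ξ·x} f(x) dσ(x)`. -/
def extension (f : S1 → ℂ) (ξ : Plane) : ℂ :=
  ∫ x : S1, Complex.exp (-Complex.I * ((inner ℝ ξ (x : Plane) : ℝ) : ℂ)) * f x ∂σ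

/-- The optimal constant: the supremum of `‖(fσ)^‖₆` over all `f ∈ L²(σ)` with `‖f‖₂ = 1`,
as an extended nonnegative number. -/
def optConst : ℝ≥0∞ :=
  ⨆ (f : S1 → ℂ) (_ : MemLp f 2 σ) (_ : eLpNorm f 2 σ = 1), eLpNorm (extension f) 6 volume

/-- The cap with center `z` and radius `r`: the points of the circle in the open hemisphere
around `z` whose orthogonal projection to the orthogonal complement of `z` has norm `< r`. -/
def cap (z : S1) (r : ℝ) : Set S1 :=
  {y | 0 < inner ℝ (y : Plane) (z : Plane) ∧
    ‖((Submodule.span ℝ {(z : Plane)})ᗮ).starProjection (y : Plane)‖ < r}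

end CircleExtension

end

/-! Squaring turns the `L^6` norm into an `L^3` norm. On a quarter arc the square of the extension
of `w` is twice the Fourier transform of a density living on the sums of two points of the arc. On
ordered pairs of angles the sum map is injective with Jacobian `sin (φ - θ)`
(`exists_convolution_density`), so Hausdorff–Young from `L^{3/2}` to `L^3`
(`lintegral_enorm_fourier_cube_le`) bounds the sixth power of the `L^6` norm by a multiple of the
square of `∬ |w(θ)|^{3/2} |w(φ)|^{3/2} |φ - θ|^{-1/2}`.

Concentration is read off from this form (`lintegral_pair_le`). By symmetry only pairs with `|w(φ)|
≤ |w(θ)| = a` matter; they are split at distance `M / a^2`. Hölder's inequality bounds the far part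
by a multiple of `M^{-1/4} a^2`, and the near part by a multiple of `(M X)^{1/4} a^2` if the near
`φ` carry squared mass at most `X`. Both are integrable in `θ`. With `M = ρ^{-4}` and `X = ρ^8` the
form is `O(ρ)`.

A large extension therefore forces, for some `θ` with `a = |f(θ)|`, squared mass above `ρ^8` on the
set `|φ - θ| < M / a^2`, `|f(φ)| ≤ a` (`exists_arc_concentration`). The cap around `θ` of radius
`min (M / a^2) 1` contains this set and has measure `O(M / a^2)`. Cutting `f` to the points of the
cap where `|f| ≤ a` gives `g`: the height bound comes from `a`, the lower norm bound from the mass.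
Since `ρ` is a multiple of `δ^3`, the constants are powers of `δ`. Of the optimal constant only
positivity is used, not finiteness. -/

/-! ### Plancherel for integrable square-integrable functions -/

open FourierTransform in
theorem fourierLp_ae_eq_fourier {V : Type*} [NormedAddCommGroup V] [InnerProductSpace ℝ V]
    [FiniteDimensional ℝ V] [MeasurableSpace V] [BorelSpace V] {f : V → ℂ}
    (hf : Integrable f) (hf2 : MemLp f 2) :
    (𝓕 (hf2.toLp f) : Lp ℂ 2 (volume : Measure V)) =ᵐ[volume] 𝓕 f := by
  have hcont : Continuous (𝓕 f) :=
    VectorFourier.fourierIntegral_continuous Real.continuous_fourierChar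
      (innerSL ℝ).continuous₂ hf
  -- Both transforms satisfy the multiplication formula against test functions: one as a tempered
  -- distribution, the other by Fubini.
  apply ae_eq_of_integral_contDiff_smul_eq
  · exact (Lp.memLp _).locallyIntegrable (by norm_num)
  · exact hcont.locallyIntegrable
  · intro g g_smooth g_cpt
    have hg₁ : HasCompactSupport (Complex.ofRealCLM ∘ g) := g_cpt.comp_left rfl
    have hg₂ : ContDiff ℝ (⊤ : ℕ∞) (Complex.ofRealCLM ∘ g) :=
      Complex.ofRealCLM.contDiff.comp g_smooth
    set G : SchwartzMap V ℂ := hg₁.toSchwartzMap hg₂ with hG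
    have hGx : ∀ x, G x = (g x : ℂ) := fun x => rfl
    have h1 : Lp.toTemperedDistribution (𝓕 (hf2.toLp f) : Lp ℂ 2 (volume : Measure V)) G
        = Lp.toTemperedDistribution (hf2.toLp f) (𝓕 G) := by
      rw [← Lp.fourier_toTemperedDistribution_eq, TemperedDistribution.fourier_apply]
    rw [Lp.toTemperedDistribution_apply, Lp.toTemperedDistribution_apply] at h1
    have h2 : ∫ x, (𝓕 G) x • (hf2.toLp f) x = ∫ x, (𝓕 (G : V → ℂ)) x • f x := by
      apply integral_congr_ae
      filter_upwards [hf2.coeFn_toLp] with x hx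
      rw [hx, SchwartzMap.fourier_coe]
    have h3 : ∫ x, (𝓕 (G : V → ℂ)) x • f x = ∫ x, G x • 𝓕 f x := by
      have := VectorFourier.integral_fourierIntegral_smul_eq_flip (L := innerₗ V) (μ := volume) (ν := volume)
        Real.continuous_fourierChar (innerSL ℝ).continuous₂ G.integrable hf
      rw [flip_innerₗ] at this
      exact this
    calc _ = ∫ x, G x • (𝓕 (hf2.toLp f) : Lp ℂ 2 (volume : Measure V)) x := by
          simp [hGx]
      _ = ∫ x, G x • 𝓕 f x := by rw [h1, h2, h3]
      _ = _ := by simp [hGx]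

open FourierTransform in
theorem lintegral_enorm_fourier_sq {V : Type*} [NormedAddCommGroup V] [InnerProductSpace ℝ V]
    [FiniteDimensional ℝ V] [MeasurableSpace V] [BorelSpace V] {f : V → ℂ}
    (hf : Integrable f) (hf2 : MemLp f 2) :
    ∫⁻ ξ, ‖𝓕 f ξ‖ₑ ^ 2 = ∫⁻ x, ‖f x‖ₑ ^ 2 := by
  have h : eLpNorm (𝓕 f) 2 volume = eLpNorm f 2 volume := by
    rw [← eLpNorm_congr_ae (fourierLp_ae_eq_fourier hf hf2), ← Lp.enorm_def,
      ← Lp.enorm_toLp hf2]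
    simp only [enorm_eq_iff_norm_eq]
    exact Lp.norm_fourier_eq _
  have h2 := congrArg (· ^ 2) h
  have key : ∀ g : V → ℂ, eLpNorm g 2 volume ^ 2 = ∫⁻ x, ‖g x‖ₑ ^ 2 := by
    intro g
    have := eLpNorm_nnreal_pow_eq_lintegral (f := g) (μ := (volume : Measure V)) (p := 2) (by norm_num)
    simpa using this
  simpa [key] using h2

/-! ### Hausdorff–Young from `L^{3/2}` to `L^3` by real interpolation -/

section HausdorffYoung

open FourierTransform

variable {V : Type*} [NormedAddCommGroup V] [InnerProductSpace ℝ V]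
    [FiniteDimensional ℝ V] [MeasurableSpace V] [BorelSpace V]

/-- Marcinkiewicz splitting at the height `4B²/s²`, chosen so that the part of `f` above it has
`L^1` norm at most `s/2`. The transform of that part never exceeds `s/2`, so the lower part must
account for the other `s/2`, and Chebyshev with Plancherel applies. Here `B` bounds the integral of
`|f|^{3/2}`, not the norm. -/
theorem meas_lt_norm_fourier_le {f : V → ℂ} (hm : Measurable f) (hf : Integrable f)
    {B s : ℝ} (hB : 0 < B) (hs : 0 < s)
    (h : ∫⁻ x, ‖f x‖ₑ ^ (3 / 2 : ℝ) ≤ ENNReal.ofReal B) :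
    volume {ξ | s < ‖𝓕 f ξ‖} * ENNReal.ofReal (s ^ 2) ≤
      4 * ∫⁻ x, ({x | ‖f x‖ * s ^ 2 ≤ 4 * B ^ 2}.indicator (fun x => ‖f x‖ₑ ^ 2)) x := by
  set S : Set V := {x | ‖f x‖ * s ^ 2 ≤ 4 * B ^ 2} with hS
  have hSm : MeasurableSet S := measurableSet_le (by fun_prop) (by fun_prop)
  set f1 : V → ℂ := Sᶜ.indicator f with hf1
  set f2 : V → ℂ := S.indicator f with hf2
  have i1 : Integrable f1 := hf.indicator hSm.compl
  have i2 : Integrable f2 := hf.indicator hSm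
  have hsum : f = f2 + f1 := (Set.indicator_self_add_compl S f).symm
  have hF : 𝓕 f = 𝓕 f2 + 𝓕 f1 := by
    rw [hsum]
    exact VectorFourier.fourierIntegral_add Real.continuous_fourierChar
      (innerSL ℝ).continuous₂ i2 i1
  have hL1 : ∫⁻ x, ‖f1 x‖ₑ ≤ ENNReal.ofReal (s / 2) := by
    -- Above the cut, `|f|^{1/2} > 2B/s`.
    have hpt : ∀ x, ENNReal.ofReal (2 * B / s) * ‖f1 x‖ₑ ≤ ‖f x‖ₑ ^ (3 / 2 : ℝ) := by
      intro x
      by_cases hx : x ∈ S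
      · simp [hf1, hx]
      · have hx' : 4 * B ^ 2 < ‖f x‖ * s ^ 2 := by simpa [hS] using hx
        have : f1 x = f x := by simp [hf1, hx]
        rw [this, ← ofReal_norm, ENNReal.ofReal_rpow_of_nonneg (norm_nonneg _) (by norm_num),
          ← ENNReal.ofReal_mul (by positivity)]
        apply ENNReal.ofReal_le_ofReal
        have e1 : (3 / 2 : ℝ) = 1 / 2 + 1 := by norm_num
        have hpos : 0 < ‖f x‖ := by
          by_contra hc
          have : ‖f x‖ = 0 := le_antisymm (not_lt.mp hc) (norm_nonneg _)
          rw [this] at hx'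
          nlinarith [sq_nonneg B]
        rw [e1, Real.rpow_add_one hpos.ne', ← Real.sqrt_eq_rpow]
        apply mul_le_mul_of_nonneg_right _ hpos.le
        apply Real.le_sqrt_of_sq_le
        rw [div_pow, div_le_iff₀ (by positivity)]
        nlinarith
    have h3 : ENNReal.ofReal (2 * B / s) * ∫⁻ x, ‖f1 x‖ₑ ≤ ENNReal.ofReal B := by
      rw [← lintegral_const_mul' _ _ ENNReal.ofReal_ne_top]
      exact (lintegral_mono hpt).trans h
    have h4 : ENNReal.ofReal B = ENNReal.ofReal (2 * B / s) * ENNReal.ofReal (s / 2) := by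
      rw [← ENNReal.ofReal_mul (by positivity)]
      congr 1
      field_simp
    rw [h4] at h3
    exact (ENNReal.mul_le_mul_iff_right (by simp; positivity) ENNReal.ofReal_ne_top).mp h3
  have hsup : ∀ ξ, ‖𝓕 f1 ξ‖ ≤ s / 2 := by
    intro ξ
    have h5 : ‖𝓕 f1 ξ‖ ≤ ∫ x, ‖f1 x‖ :=
      VectorFourier.norm_fourierIntegral_le_integral_norm _ _ _ _ _
    have h6 : ∫ x, ‖f1 x‖ ≤ s / 2 := by
      rw [integral_norm_eq_lintegral_enorm i1.aestronglyMeasurable]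
      exact ENNReal.toReal_le_of_le_ofReal (by positivity) hL1
    exact h5.trans h6
  have m2 : MemLp f2 2 := by
    rw [memLp_two_iff_integrable_sq_norm i2.aestronglyMeasurable]
    refine (hf.norm.const_mul (4 * B ^ 2 / s ^ 2)).mono
      (i2.aestronglyMeasurable.norm.pow 2) (Filter.Eventually.of_forall fun x => ?_)
    by_cases hx : x ∈ S
    · have : f2 x = f x := by simp [hf2, hx]
      have hx' : ‖f x‖ * s ^ 2 ≤ 4 * B ^ 2 := hx
      have hx2 : ‖f x‖ ≤ 4 * B ^ 2 / s ^ 2 := by rwa [le_div_iff₀ (by positivity)]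
      rw [this, Real.norm_of_nonneg (by positivity), Real.norm_of_nonneg (by positivity), pow_two]
      exact mul_le_mul_of_nonneg_right hx2 (norm_nonneg _)
    · have : f2 x = 0 := by simp [hf2, hx]
      rw [this]
      simp only [norm_zero, ne_eq, OfNat.ofNat_ne_zero, not_false_eq_true, zero_pow]
      positivity
  have hmeas : volume {ξ | s < ‖𝓕 f ξ‖} ≤ volume {ξ | ENNReal.ofReal ((s / 2) ^ 2) ≤ ‖𝓕 f2 ξ‖ₑ ^ 2} := by
    apply measure_mono
    intro ξ hξ
    have hξ' : s < ‖𝓕 f ξ‖ := hξ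
    have : ‖𝓕 f ξ‖ ≤ ‖𝓕 f2 ξ‖ + ‖𝓕 f1 ξ‖ := by
      rw [hF]; exact norm_add_le _ _
    have h8 : s / 2 ≤ ‖𝓕 f2 ξ‖ := by linarith [hsup ξ]
    simp only [Set.mem_ofPred_eq]
    rw [← ofReal_norm, ← ENNReal.ofReal_pow (norm_nonneg _)]
    apply ENNReal.ofReal_le_ofReal
    gcongr
  have hcont : Continuous (𝓕 f2) :=
    VectorFourier.fourierIntegral_continuous Real.continuous_fourierChar
      (innerSL ℝ).continuous₂ i2
  have hcheb := mul_meas_ge_le_lintegral₀ (μ := (volume : Measure V)) (f := fun ξ => ‖𝓕 f2 ξ‖ₑ ^ 2)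
    (by fun_prop) (ENNReal.ofReal ((s / 2) ^ 2))
  rw [lintegral_enorm_fourier_sq i2 m2] at hcheb
  have h9 : ENNReal.ofReal (s ^ 2) = 4 * ENNReal.ofReal ((s / 2) ^ 2) := by
    rw [show (4 : ℝ≥0∞) = ENNReal.ofReal 4 by simp, ← ENNReal.ofReal_mul (by norm_num)]
    congr 1; ring
  have h10 : ∀ x, S.indicator (fun x => ‖f x‖ₑ ^ 2) x = ‖f2 x‖ₑ ^ 2 := by
    intro x
    by_cases hx : x ∈ S <;> simp [hf2, hx]
  simp_rw [h10]
  calc _ ≤ volume {ξ | ENNReal.ofReal ((s / 2) ^ 2) ≤ ‖𝓕 f2 ξ‖ₑ ^ 2} * ENNReal.ofReal (s ^ 2) := by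
        gcongr
    _ = 4 * (ENNReal.ofReal ((s / 2) ^ 2) * volume {ξ | ENNReal.ofReal ((s / 2) ^ 2) ≤ ‖𝓕 f2 ξ‖ₑ ^ 2}) := by
        rw [h9]; ring
    _ ≤ _ := by gcongr

theorem lintegral_enorm_fourier_cube_le_of_measurable {f : V → ℂ} (hm : Measurable f)
    (hf : Integrable f) {B : ℝ} (hB : 0 < B)
    (h : ∫⁻ x, ‖f x‖ₑ ^ (3 / 2 : ℝ) ≤ ENNReal.ofReal B) :
    ∫⁻ ξ, ‖𝓕 f ξ‖ₑ ^ 3 ≤ ENNReal.ofReal (24 * B ^ 2) := by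
  have hcont : Continuous (𝓕 f) :=
    VectorFourier.fourierIntegral_continuous Real.continuous_fourierChar
      (innerSL ℝ).continuous₂ hf
  have hlayer := lintegral_rpow_eq_lintegral_meas_lt_mul (volume : Measure V)
    (f := fun ξ => ‖𝓕 f ξ‖) (Filter.Eventually.of_forall fun ξ => norm_nonneg _)
    (hcont.norm.measurable.aemeasurable) (p := 3) (by norm_num)
  have e1 : ∀ ξ, ENNReal.ofReal (‖𝓕 f ξ‖ ^ (3 : ℝ)) = ‖𝓕 f ξ‖ₑ ^ 3 := by
    intro ξ
    rw [← ofReal_norm, ← ENNReal.ofReal_pow (norm_nonneg _)]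
    norm_cast
  simp_rw [e1] at hlayer
  rw [hlayer]
  set G : ℝ → V → ℝ≥0∞ := fun s =>
    ({x | ‖f x‖ * s ^ 2 ≤ 4 * B ^ 2}.indicator (fun x => ‖f x‖ₑ ^ 2)) with hG
  have hGm : Measurable (Function.uncurry G) := by
    have : Function.uncurry G = {q : ℝ × V | ‖f q.2‖ * q.1 ^ 2 ≤ 4 * B ^ 2}.indicator
        (fun q => ‖f q.2‖ₑ ^ 2) := by
      ext ⟨s, x⟩
      simp [G, Set.indicator, Function.uncurry]
    rw [this]
    refine Measurable.indicator (by fun_prop) (measurableSet_le (by fun_prop) (by fun_prop))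
  have step1 : ∫⁻ s in Set.Ioi (0 : ℝ), volume {ξ | s < ‖𝓕 f ξ‖} * ENNReal.ofReal (s ^ ((3 : ℝ) - 1))
      ≤ ∫⁻ s in Set.Ioi (0 : ℝ), 4 * ∫⁻ x, G s x := by
    apply setLIntegral_mono' measurableSet_Ioi
    intro s hs
    have := meas_lt_norm_fourier_le hm hf hB hs h
    have e2 : s ^ ((3 : ℝ) - 1) = s ^ 2 := by norm_num
    rw [e2]
    exact this
  -- After Fubini, a point `x` contributes only for `s ≤ 2B / √|f x|`, which trades `|f x|^2` for
  -- `2B |f x|^{3/2}`.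
  have step2 : ∀ x, ∫⁻ s in Set.Ioi (0 : ℝ), G s x ≤ ENNReal.ofReal (2 * B) * ‖f x‖ₑ ^ (3 / 2 : ℝ) := by
    intro x
    by_cases hx : f x = 0
    · have : ∀ s, G s x = 0 := by
        intro s; simp [G, Set.indicator, hx]
      simp [this]
    · have hpos : 0 < ‖f x‖ := norm_pos_iff.mpr hx
      have hsq : 0 < Real.sqrt ‖f x‖ := Real.sqrt_pos.mpr hpos
      calc ∫⁻ s in Set.Ioi (0 : ℝ), G s x
          ≤ ∫⁻ s, (Set.Ioc 0 (2 * B / Real.sqrt ‖f x‖)).indicator (fun _ => ‖f x‖ₑ ^ 2) s := by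
            rw [← lintegral_indicator measurableSet_Ioi]
            apply lintegral_mono
            intro s
            by_cases h0 : s ∈ Set.Ioi (0 : ℝ)
            · by_cases h1 : ‖f x‖ * s ^ 2 ≤ 4 * B ^ 2
              · have : s ∈ Set.Ioc 0 (2 * B / Real.sqrt ‖f x‖) := by
                  refine ⟨h0, ?_⟩
                  rw [le_div_iff₀ hsq]
                  refine (pow_le_pow_iff_left₀ (mul_nonneg (le_of_lt h0) hsq.le) (by positivity) two_ne_zero).mp ?_
                  rw [mul_pow, Real.sq_sqrt hpos.le]
                  linarith
                rw [Set.indicator_of_mem this, Set.indicator_of_mem h0]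
                exact Set.indicator_le_self' (fun _ _ => zero_le) _
              · have : G s x = 0 := by
                  simp only [G]
                  exact Set.indicator_of_notMem (by simpa using h1) _
                rw [Set.indicator_of_mem h0, this]
                exact zero_le
            · rw [Set.indicator_of_notMem h0]
              exact zero_le
        _ = ‖f x‖ₑ ^ 2 * ENNReal.ofReal (2 * B / Real.sqrt ‖f x‖) := by
            rw [lintegral_indicator measurableSet_Ioc]
            simp
        _ = _ := by
            rw [← ofReal_norm, ENNReal.ofReal_rpow_of_nonneg hpos.le (by norm_num),
              ← ENNReal.ofReal_pow hpos.le, ← ENNReal.ofReal_mul (by positivity),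
              ← ENNReal.ofReal_mul (by positivity)]
            congr 1
            have e1 : (3 / 2 : ℝ) = 1 / 2 + 1 := by norm_num
            rw [e1, Real.rpow_add_one hpos.ne', ← Real.sqrt_eq_rpow]
            have := Real.mul_self_sqrt hpos.le
            field_simp
            nlinarith
  calc _ ≤ ENNReal.ofReal 3 * ∫⁻ s in Set.Ioi (0 : ℝ), 4 * ∫⁻ x, G s x := by gcongr
    _ = ENNReal.ofReal 3 * (4 * ∫⁻ x, ∫⁻ s in Set.Ioi (0 : ℝ), G s x) := by
        rw [lintegral_const_mul' _ _ (by simp), lintegral_lintegral_swap hGm.aemeasurable]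
    _ ≤ ENNReal.ofReal 3 * (4 * ∫⁻ x, ENNReal.ofReal (2 * B) * ‖f x‖ₑ ^ (3 / 2 : ℝ)) := by
        gcongr with x; exact step2 x
    _ ≤ ENNReal.ofReal 3 * (4 * (ENNReal.ofReal (2 * B) * ENNReal.ofReal B)) := by
        rw [lintegral_const_mul' _ _ ENNReal.ofReal_ne_top]
        gcongr
    _ = _ := by
        rw [show (4 : ℝ≥0∞) = ENNReal.ofReal 4 by simp, ← ENNReal.ofReal_mul (by positivity),
          ← ENNReal.ofReal_mul (by positivity), ← ENNReal.ofReal_mul (by positivity)]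
        congr 1; ring

/-- A Hausdorff–Young inequality: the Fourier transform maps `L^{3/2}` to `L^3`. -/
theorem lintegral_enorm_fourier_cube_le {f : V → ℂ} (hf : Integrable f) {B : ℝ} (hB : 0 < B)
    (h : ∫⁻ x, ‖f x‖ₑ ^ (3 / 2 : ℝ) ≤ ENNReal.ofReal B) :
    ∫⁻ ξ, ‖𝓕 f ξ‖ₑ ^ 3 ≤ ENNReal.ofReal (24 * B ^ 2) := by
  obtain ⟨g, hg, hfg⟩ := hf.aestronglyMeasurable
  have h1 : 𝓕 f = 𝓕 g := by
    ext ξ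
    simp only [Real.fourier_eq]
    apply integral_congr_ae
    filter_upwards [hfg] with x hx
    rw [hx]
  rw [h1]
  apply lintegral_enorm_fourier_cube_le_of_measurable hg.measurable (hf.congr hfg) hB
  rwa [lintegral_congr_ae (g := fun x => ‖f x‖ₑ ^ (3 / 2 : ℝ))]
  filter_upwards [hfg] with x hx
  rw [hx]

end HausdorffYoung

/-! ### A Hardy–Littlewood–Sobolev form under a non-concentration hypothesis -/

section HLS

theorem lintegral_comp_abs_sub {h : ℝ → ℝ≥0∞} (hh : Measurable h) (θ : ℝ) :
    ∫⁻ φ, h |φ - θ| = 2 * ∫⁻ t in Set.Ioi (0 : ℝ), h t := by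
  rw [lintegral_sub_right_eq_self (μ := (volume : Measure ℝ)) (fun x => h |x|) θ,
    ← lintegral_add_compl _ (measurableSet_Ioi (a := (0 : ℝ))), two_mul]
  congr 1
  · refine setLIntegral_congr_fun measurableSet_Ioi fun x hx => ?_
    rw [abs_of_pos hx]
  · have h1 : ∫⁻ x in (Set.Ioi (0 : ℝ))ᶜ, h |x| = ∫⁻ x in Set.Iio (0 : ℝ), h (-x) := by
      rw [Set.compl_Ioi, ← Measure.restrict_congr_set Iio_ae_eq_Iic]
      refine setLIntegral_congr_fun measurableSet_Iio fun x hx => ?_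
      rw [abs_of_neg hx]
    rw [h1]
    have h2 := (Measure.measurePreserving_neg (volume : Measure ℝ)).setLIntegral_comp_preimage
      (measurableSet_Ioi (a := (0 : ℝ))) hh
    simpa using h2

theorem lintegral_abs_sub_lt_rpow {S : ℝ} (hS : 0 < S) (θ : ℝ) :
    ∫⁻ φ in {φ | |φ - θ| < S}, ENNReal.ofReal (|φ - θ| ^ (-(2 / 3) : ℝ)) =
      ENNReal.ofReal (6 * S ^ (1 / 3 : ℝ)) := by
  rw [← lintegral_indicator (measurableSet_lt (by fun_prop) (by fun_prop))]
  have hm : Measurable ((Set.Iio S).indicator fun t : ℝ => ENNReal.ofReal (t ^ (-(2 / 3) : ℝ))) :=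
    Measurable.indicator (by fun_prop) measurableSet_Iio
  have := lintegral_comp_abs_sub hm θ
  refine Eq.trans ?_ (this.trans ?_)
  · rfl
  · have hint : IntegrableOn (fun t : ℝ => t ^ (-(2 / 3) : ℝ)) (Set.Ioc 0 S) := by
      rw [← intervalIntegrable_iff_integrableOn_Ioc_of_le hS.le]
      exact intervalIntegral.intervalIntegrable_rpow' (by norm_num)
    rw [setLIntegral_indicator measurableSet_Iio, Set.inter_comm, Set.Ioi_inter_Iio,
      Measure.restrict_congr_set Ioo_ae_eq_Ioc,
      ← ofReal_integral_eq_lintegral_ofReal hint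
        ((ae_restrict_mem measurableSet_Ioc).mono fun t ht => Real.rpow_nonneg ht.1.le _),
      ← intervalIntegral.integral_of_le hS.le, integral_rpow (Or.inl (by norm_num)),
      show (2 : ℝ≥0∞) = ENNReal.ofReal 2 by simp, ← ENNReal.ofReal_mul (by norm_num)]
    congr 1
    norm_num
    ring

theorem lintegral_le_abs_sub_rpow {S : ℝ} (hS : 0 < S) (θ : ℝ) :
    ∫⁻ φ in {φ | S ≤ |φ - θ|}, ENNReal.ofReal (|φ - θ| ^ (-2 : ℝ)) =
      ENNReal.ofReal (2 / S) := by
  rw [← lintegral_indicator (measurableSet_le (by fun_prop) (by fun_prop))]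
  have hm : Measurable ((Set.Ici S).indicator fun t : ℝ => ENNReal.ofReal (t ^ (-2 : ℝ))) :=
    Measurable.indicator (by fun_prop) measurableSet_Ici
  have := lintegral_comp_abs_sub hm θ
  refine Eq.trans ?_ (this.trans ?_)
  · rfl
  · have hint : IntegrableOn (fun t : ℝ => t ^ (-2 : ℝ)) (Set.Ioi S) :=
      integrableOn_Ioi_rpow_of_lt (by norm_num) hS
    have hset : Set.Ici S ∩ Set.Ioi 0 = Set.Ici S :=
      Set.inter_eq_left.mpr fun x hx => lt_of_lt_of_le hS hx
    rw [setLIntegral_indicator measurableSet_Ici, hset,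
      ← Measure.restrict_congr_set Ioi_ae_eq_Ici,
      ← ofReal_integral_eq_lintegral_ofReal hint
        ((ae_restrict_mem measurableSet_Ioi).mono fun t ht =>
          Real.rpow_nonneg (hS.trans ht).le _),
      integral_Ioi_rpow_of_lt (by norm_num) hS,
      show (2 : ℝ≥0∞) = ENNReal.ofReal 2 by simp, ← ENNReal.ofReal_mul (by norm_num)]
    congr 1
    norm_num
    rw [Real.rpow_neg_one]
    ring

/-- Hölder with exponents `4` and `4/3`: the kernel becomes `|t|^{-2/3}`, integrable at the origin,
while `b^6 ≤ a^4 b^2` turns the height cap into a gain from the local mass. -/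
theorem lintegral_near {b : ℝ → ℝ≥0∞} (hb : Measurable b) {a S : ℝ} (ha : 0 < a) (hS : 0 < S) (θ : ℝ)
    {X : ℝ} (hX : 0 ≤ X)
    (h : ∫⁻ φ in {φ | |φ - θ| < S ∧ b φ ≤ ENNReal.ofReal a}, b φ ^ 2 ≤ ENNReal.ofReal X) :
    ∫⁻ φ in {φ | |φ - θ| < S ∧ b φ ≤ ENNReal.ofReal a},
      b φ ^ (3 / 2 : ℝ) * ENNReal.ofReal (|φ - θ| ^ (-(1 / 2) : ℝ)) ≤
      ENNReal.ofReal (6 ^ (3 / 4 : ℝ) * a * (S * X) ^ (1 / 4 : ℝ)) := by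
  set E : Set ℝ := {φ | |φ - θ| < S ∧ b φ ≤ ENNReal.ofReal a} with hE
  have hEm : MeasurableSet E :=
    MeasurableSet.inter (s₁ := {φ | |φ - θ| < S}) (s₂ := {φ | b φ ≤ ENNReal.ofReal a})
      (measurableSet_lt (by fun_prop) (by fun_prop)) (measurableSet_le hb (by fun_prop))
  have hpq : (4 : ℝ).HolderConjugate (4 / 3) := by
    rw [Real.holderConjugate_iff]; norm_num
  have H := ENNReal.lintegral_mul_le_Lp_mul_Lq (volume.restrict E) hpq
    (f := fun φ => b φ ^ (3 / 2 : ℝ)) (g := fun φ => ENNReal.ofReal (|φ - θ| ^ (-(1 / 2) : ℝ)))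
    (by fun_prop) (by fun_prop)
  refine H.trans ?_
  have h1 : ∫⁻ φ in E, (b φ ^ (3 / 2 : ℝ)) ^ (4 : ℝ) ≤ ENNReal.ofReal (a ^ 4 * X) := by
    calc _ ≤ ∫⁻ φ in E, ENNReal.ofReal (a ^ 4) * b φ ^ 2 := by
          apply setLIntegral_mono' hEm
          intro φ hφ
          have e : (b φ ^ (3 / 2 : ℝ)) ^ (4 : ℝ) = b φ ^ 4 * b φ ^ 2 := by
            rw [← ENNReal.rpow_mul, ← pow_add]
            norm_num
          rw [e, ENNReal.ofReal_pow ha.le]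
          gcongr
          exact hφ.2
      _ ≤ _ := by
          rw [lintegral_const_mul' _ _ ENNReal.ofReal_ne_top, ENNReal.ofReal_mul (by positivity)]
          gcongr
  have h2 : ∫⁻ φ in E, ENNReal.ofReal (|φ - θ| ^ (-(1 / 2) : ℝ)) ^ (4 / 3 : ℝ) ≤
      ENNReal.ofReal (6 * S ^ (1 / 3 : ℝ)) := by
    rw [← lintegral_abs_sub_lt_rpow hS θ]
    refine le_trans (lintegral_mono_set (fun φ hφ => hφ.1)) (le_of_eq ?_)
    congr 1; ext φ
    rw [ENNReal.ofReal_rpow_of_nonneg (by positivity) (by norm_num), ← Real.rpow_mul (abs_nonneg _)]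
    norm_num
  calc _ ≤ ENNReal.ofReal (a ^ 4 * X) ^ (1 / 4 : ℝ) *
        ENNReal.ofReal (6 * S ^ (1 / 3 : ℝ)) ^ (1 / (4 / 3) : ℝ) := by gcongr
    _ = _ := by
        rw [ENNReal.ofReal_rpow_of_nonneg (by positivity) (by norm_num),
          ENNReal.ofReal_rpow_of_nonneg (by positivity) (by norm_num),
          ← ENNReal.ofReal_mul (by positivity)]
        congr 1
        rw [Real.mul_rpow (by positivity) hX, Real.mul_rpow (by positivity) (by positivity),
          Real.mul_rpow hS.le hX, ← Real.rpow_mul hS.le, ← Real.rpow_natCast, ← Real.rpow_mul ha.le]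
        norm_num
        ring

/-- Hölder with the exponents exchanged: the total mass absorbs `b^2`, and the kernel becomes
`|t|^{-2}`, integrable at infinity. -/
theorem lintegral_far {b : ℝ → ℝ≥0∞} (hb : Measurable b) {S : ℝ} (hS : 0 < S) (θ : ℝ)
    (h : ∫⁻ φ, b φ ^ 2 ≤ 1) :
    ∫⁻ φ in {φ | S ≤ |φ - θ|},
      b φ ^ (3 / 2 : ℝ) * ENNReal.ofReal (|φ - θ| ^ (-(1 / 2) : ℝ)) ≤
      ENNReal.ofReal ((2 / S) ^ (1 / 4 : ℝ)) := by
  set E : Set ℝ := {φ | S ≤ |φ - θ|} with hE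
  have hpq : (4 / 3 : ℝ).HolderConjugate 4 := by
    rw [Real.holderConjugate_iff]; norm_num
  have H := ENNReal.lintegral_mul_le_Lp_mul_Lq (volume.restrict E) hpq
    (f := fun φ => b φ ^ (3 / 2 : ℝ)) (g := fun φ => ENNReal.ofReal (|φ - θ| ^ (-(1 / 2) : ℝ)))
    (by fun_prop) (by fun_prop)
  refine H.trans ?_
  have h1 : ∫⁻ φ in E, (b φ ^ (3 / 2 : ℝ)) ^ (4 / 3 : ℝ) ≤ 1 := by
    refine le_trans (le_trans (setLIntegral_le_lintegral _ _) (le_of_eq ?_)) h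
    congr 1; ext φ
    rw [← ENNReal.rpow_mul]
    norm_num
  have h2 : ∫⁻ φ in E, ENNReal.ofReal (|φ - θ| ^ (-(1 / 2) : ℝ)) ^ (4 : ℝ) ≤
      ENNReal.ofReal (2 / S) := by
    rw [← lintegral_le_abs_sub_rpow hS θ]
    refine le_of_eq ?_
    congr 1; ext φ
    rw [ENNReal.ofReal_rpow_of_nonneg (by positivity) (by norm_num), ← Real.rpow_mul (abs_nonneg _)]
    norm_num
  calc _ ≤ (1 : ℝ≥0∞) ^ (1 / (4 / 3) : ℝ) *
        ENNReal.ofReal (2 / S) ^ (1 / 4 : ℝ) := by gcongr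
    _ = _ := by
        rw [ENNReal.ofReal_rpow_of_nonneg (by positivity) (by norm_num)]
        simp

/-- The cut at `S = M / b(θ)^2` is the scale-invariant one: both the near and the far contribution
then become multiples of `b(θ)^2`, which can be integrated in `θ`. -/
theorem lintegral_pair_half {b : ℝ → ℝ≥0∞} (hb : Measurable b) (hfin : ∀ θ, b θ ≠ ⊤)
    (h : ∫⁻ φ, b φ ^ 2 ≤ 1) {M X : ℝ} (hM : 0 < M) (hX : 0 ≤ X)
    (hconc : ∀ θ, b θ ≠ 0 → ∫⁻ φ in {φ | |φ - θ| < M / (b θ).toReal ^ 2 ∧ b φ ≤ b θ}, b φ ^ 2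
      ≤ ENNReal.ofReal X) (θ : ℝ) :
    ∫⁻ φ in {φ | b φ ≤ b θ}, b θ ^ (3 / 2 : ℝ) * b φ ^ (3 / 2 : ℝ) *
      ENNReal.ofReal (|φ - θ| ^ (-(1 / 2) : ℝ)) ≤
      ENNReal.ofReal (6 ^ (3 / 4 : ℝ) * (M * X) ^ (1 / 4 : ℝ) + (2 / M) ^ (1 / 4 : ℝ)) * b θ ^ 2 := by
  by_cases h0 : b θ = 0
  · simp [h0]
  set a := (b θ).toReal with ha
  have hapos : 0 < a := ENNReal.toReal_pos h0 (hfin θ)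
  have hba : b θ = ENNReal.ofReal a := (ENNReal.ofReal_toReal (hfin θ)).symm
  set S := M / a ^ 2 with hS
  have hSpos : 0 < S := by positivity
  have hc := hconc θ h0
  have near := lintegral_near hb hapos hSpos θ hX (by rw [← hba]; exact hc)
  have far := lintegral_far hb hSpos θ h
  have hsub : {φ | b φ ≤ b θ} ⊆ {φ | |φ - θ| < S ∧ b φ ≤ ENNReal.ofReal a} ∪ {φ | S ≤ |φ - θ|} := by
    intro φ hφ
    rcases lt_or_ge (|φ - θ|) S with hlt | hge
    · exact Or.inl ⟨hlt, by rw [← hba]; exact hφ⟩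
    · exact Or.inr hge
  calc _ = b θ ^ (3 / 2 : ℝ) * ∫⁻ φ in {φ | b φ ≤ b θ}, b φ ^ (3 / 2 : ℝ) *
      ENNReal.ofReal (|φ - θ| ^ (-(1 / 2) : ℝ)) := by
        rw [← lintegral_const_mul _ (by fun_prop)]
        simp_rw [mul_assoc]
    _ ≤ b θ ^ (3 / 2 : ℝ) * (ENNReal.ofReal (6 ^ (3 / 4 : ℝ) * a * (S * X) ^ (1 / 4 : ℝ)) +
          ENNReal.ofReal ((2 / S) ^ (1 / 4 : ℝ))) := by
        gcongr
        exact ((lintegral_mono_set hsub).trans (lintegral_union_le _ _ _)).trans (add_le_add near far)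
    _ = _ := by
        rw [hba, ← ENNReal.ofReal_add (by positivity) (by positivity),
          ENNReal.ofReal_rpow_of_nonneg hapos.le (by norm_num), ← ENNReal.ofReal_pow hapos.le,
          ← ENNReal.ofReal_mul (by positivity), ← ENNReal.ofReal_mul (by positivity)]
        congr 1
        have hr : ∀ x : ℝ, 0 ≤ x → (x * (a ^ 2)) ^ (1 / 4 : ℝ) = x ^ (1 / 4 : ℝ) * a ^ (1 / 2 : ℝ) := by
          intro x hx
          rw [Real.mul_rpow hx (by positivity), ← Real.rpow_natCast, ← Real.rpow_mul hapos.le]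
          norm_num
        have e1 : (M * X) ^ (1 / 4 : ℝ) = (S * X) ^ (1 / 4 : ℝ) * a ^ (1 / 2 : ℝ) := by
          rw [← hr _ (by positivity), hS]; congr 1; field_simp
        have e2 : (2 / S) ^ (1 / 4 : ℝ) = (2 / M) ^ (1 / 4 : ℝ) * a ^ (1 / 2 : ℝ) := by
          rw [← hr _ (by positivity), hS]; congr 1; field_simp
        have e3 : a ^ (3 / 2 : ℝ) = a * a ^ (1 / 2 : ℝ) := by
          rw [show (3 / 2 : ℝ) = 1 / 2 + 1 by norm_num, Real.rpow_add_one hapos.ne']; ring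
        have e4 : a ^ (1 / 2 : ℝ) * a ^ (1 / 2 : ℝ) = a := by
          rw [← Real.rpow_add hapos]; norm_num
        rw [e1, e2, e3]
        linear_combination (a * (2 / M) ^ (1 / 4 : ℝ)) * e4

/-- The kernel is symmetric, so the larger of the two values may be taken at `θ`; this costs the
factor `2`. -/
theorem lintegral_pair_le {b : ℝ → ℝ≥0∞} (hb : Measurable b) (hfin : ∀ θ, b θ ≠ ⊤)
    (h : ∫⁻ φ, b φ ^ 2 ≤ 1) {M X : ℝ} (hM : 0 < M) (hX : 0 ≤ X)
    (hconc : ∀ θ, b θ ≠ 0 → ∫⁻ φ in {φ | |φ - θ| < M / (b θ).toReal ^ 2 ∧ b φ ≤ b θ}, b φ ^ 2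
      ≤ ENNReal.ofReal X) :
    ∫⁻ θ, ∫⁻ φ, b θ ^ (3 / 2 : ℝ) * b φ ^ (3 / 2 : ℝ) *
      ENNReal.ofReal (|φ - θ| ^ (-(1 / 2) : ℝ)) ≤
      ENNReal.ofReal (2 * (6 ^ (3 / 4 : ℝ) * (M * X) ^ (1 / 4 : ℝ) + (2 / M) ^ (1 / 4 : ℝ))) := by
  set K : ℝ → ℝ → ℝ≥0∞ := fun θ φ => b θ ^ (3 / 2 : ℝ) * b φ ^ (3 / 2 : ℝ) *
      ENNReal.ofReal (|φ - θ| ^ (-(1 / 2) : ℝ)) with hK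
  set K' : ℝ → ℝ → ℝ≥0∞ := fun θ φ => {φ | b φ ≤ b θ}.indicator (K θ) φ with hK'
  have hKs : ∀ θ φ, K θ φ = K φ θ := by
    intro θ φ
    simp only [K]
    rw [abs_sub_comm, mul_comm (b θ ^ _)]
  have hKm : Measurable (Function.uncurry K) := by
    simp only [K, Function.uncurry_def]; fun_prop
  have hK'm : Measurable (Function.uncurry K') := by
    have : Function.uncurry K' = {q : ℝ × ℝ | b q.2 ≤ b q.1}.indicator (Function.uncurry K) := by
      ext ⟨s, x⟩
      simp [K', Set.indicator, Function.uncurry]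
    rw [this]
    exact hKm.indicator (measurableSet_le (by fun_prop) (by fun_prop))
  have hle : ∀ θ φ, K θ φ ≤ K' θ φ + K' φ θ := by
    intro θ φ
    rcases le_total (b φ) (b θ) with h1 | h1
    · have : K' θ φ = K θ φ := by simp [K', h1]
      rw [this]; exact le_self_add
    · have : K' φ θ = K θ φ := by simp [K', h1, hKs θ φ]
      rw [this]; exact le_add_self
  set c := 6 ^ (3 / 4 : ℝ) * (M * X) ^ (1 / 4 : ℝ) + (2 / M) ^ (1 / 4 : ℝ) with hc
  have hcpos : 0 ≤ c := by positivity
  have hhalf : ∫⁻ θ, ∫⁻ φ, K' θ φ ≤ ENNReal.ofReal c := by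
    calc _ ≤ ∫⁻ θ, ENNReal.ofReal c * b θ ^ 2 := by
          gcongr with θ
          rw [lintegral_indicator (measurableSet_le hb (by fun_prop))]
          exact lintegral_pair_half hb hfin h hM hX hconc θ
      _ ≤ ENNReal.ofReal c * 1 := by
          rw [lintegral_const_mul' _ _ ENNReal.ofReal_ne_top]
          gcongr
      _ = _ := mul_one _
  calc _ ≤ ∫⁻ θ, ∫⁻ φ, (K' θ φ + K' φ θ) := by
        gcongr with θ φ; exact hle θ φ
    _ = (∫⁻ θ, ∫⁻ φ, K' θ φ) + ∫⁻ θ, ∫⁻ φ, K' φ θ := by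
        rw [← lintegral_add_left]
        · congr 1; ext θ
          exact lintegral_add_left (hK'm.comp (by fun_prop : Measurable fun φ => (θ, φ))) _
        · exact hK'm.lintegral_prod_right'
    _ = (∫⁻ θ, ∫⁻ φ, K' θ φ) + ∫⁻ φ, ∫⁻ θ, K' φ θ := by
        congr 1
        exact (lintegral_lintegral_swap (f := K') hK'm.aemeasurable).symm
    _ ≤ ENNReal.ofReal c + ENNReal.ofReal c := add_le_add hhalf hhalf
    _ = _ := by rw [← ENNReal.ofReal_add hcpos hcpos, two_mul]

end HLS

/-! ### Arc length in the angle variable -/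

namespace CircleExtension

/-- The identification of `ℝ × ℝ` with the Euclidean plane. -/
noncomputable def planeEquiv : ℝ × ℝ ≃ᵐ Plane :=
  (MeasurableEquiv.finTwoArrow (α := ℝ)).symm.trans (MeasurableEquiv.toLp 2 (Fin 2 → ℝ))

theorem planeEquiv_apply (p : ℝ × ℝ) : planeEquiv p = !₂[p.1, p.2] := rfl

theorem measurePreserving_planeEquiv : MeasurePreserving planeEquiv :=
  (PiLp.volume_preserving_toLp (Fin 2)).comp (volume_preserving_finTwoArrow ℝ).symm

/-- The point of the unit circle at angle `θ`. -/
noncomputable def circlePoint (θ : ℝ) : S1 :=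
  ⟨!₂[Real.cos θ, Real.sin θ], by
    simp [EuclideanSpace.norm_eq, Fin.sum_univ_two]⟩

theorem coe_circlePoint (θ : ℝ) : (circlePoint θ : Plane) = !₂[Real.cos θ, Real.sin θ] := rfl

theorem continuous_circlePoint : Continuous circlePoint := by
  apply Continuous.subtype_mk
  apply (PiLp.continuous_toLp 2 _).comp
  apply continuous_pi
  intro i
  fin_cases i
  · exact Real.continuous_cos
  · exact Real.continuous_sin

open scoped Pointwise in
theorem smul_circlePoint_mem_iff {s : Set S1} {r θ : ℝ} (hr : 0 < r) :
    r • (circlePoint θ : Plane) ∈ Set.Ioo (0 : ℝ) 1 • ((↑) '' s : Set Plane) ↔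
      r < 1 ∧ circlePoint θ ∈ s := by
  constructor
  · rintro ⟨c, ⟨hc0, hc1⟩, _, ⟨y, hy, rfl⟩, h⟩
    have h' : c • (y : Plane) = r • (circlePoint θ : Plane) := h
    have hn := congrArg norm h'
    rw [norm_smul, norm_smul, norm_eq_of_mem_sphere, norm_eq_of_mem_sphere, mul_one, mul_one,
      Real.norm_of_nonneg hc0.le, Real.norm_of_nonneg hr.le] at hn
    subst hn
    have : y = circlePoint θ := Subtype.ext (smul_right_injective _ hc0.ne' h')
    exact ⟨hc1, this ▸ hy⟩
  · rintro ⟨h1, h2⟩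
    exact ⟨r, ⟨hr, h1⟩, _, ⟨_, h2, rfl⟩, rfl⟩

open scoped Pointwise in
theorem measurableSet_Ioo_smul_sphere {s : Set S1} (hs : MeasurableSet s) :
    MeasurableSet (Set.Ioo (0 : ℝ) 1 • ((↑) '' s : Set Plane)) := by
  have h : (((↑) : ({0}ᶜ : Set Plane) → Plane) ''
      (homeomorphUnitSphereProd Plane ⁻¹' s ×ˢ Set.Iio (⟨1, Set.mem_Ioi.2 one_pos⟩ : Set.Ioi (0 : ℝ)))) =
      Set.Ioo (0 : ℝ) 1 • ((↑) '' s : Set Plane) := by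
    rw [← Set.image2_smul, Set.image2_image_right, ← Homeomorph.image_symm, Set.image_image,
      ← Set.image_subtype_val_Ioi_Iio ⟨1, Set.mem_Ioi.2 one_pos⟩, Set.image2_image_left, Set.image2_swap, ← Set.image_prod]
    rfl
  rw [← h]
  exact (MeasurableEmbedding.subtype_coe (measurableSet_singleton _).compl).measurableSet_image.mpr
    ((homeomorphUnitSphereProd Plane).measurable (hs.prod measurableSet_Iio))

open scoped Pointwise in
/-- The arc length measure is the image of Lebesgue measure under the angle parametrization. -/
theorem σ_eq_map : σ = (volume.restrict (Set.Ioo (-Real.pi) Real.pi)).map circlePoint := by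
  ext s hs
  have hcm : Measurable circlePoint := continuous_circlePoint.measurable
  rw [Measure.map_apply hcm hs, σ, Measure.toSphere_apply' _ hs]
  set A := Set.Ioo (0 : ℝ) 1 • ((↑) '' s : Set Plane) with hA
  have hAm : MeasurableSet A := measurableSet_Ioo_smul_sphere hs
  have h1 : volume A = ∫⁻ p : ℝ × ℝ, (planeEquiv ⁻¹' A).indicator 1 p := by
    rw [lintegral_indicator_one (planeEquiv.measurable hAm),
      measurePreserving_planeEquiv.measure_preimage hAm.nullMeasurableSet]
  rw [h1, ← lintegral_comp_polarCoord_symm]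
  -- In polar coordinates the cone over `s` is a product, so radius and angle separate.
  have h2 : ∫⁻ p in polarCoord.target, ENNReal.ofReal p.1 •
        (planeEquiv ⁻¹' A).indicator (1 : ℝ × ℝ → ℝ≥0∞) (polarCoord.symm p) =
      ∫⁻ p in Set.Ioi (0 : ℝ) ×ˢ Set.Ioo (-Real.pi) Real.pi,
        (Set.Iio (1 : ℝ)).indicator ENNReal.ofReal p.1 *
          (circlePoint ⁻¹' s).indicator 1 p.2 := by
    refine setLIntegral_congr_fun (measurableSet_Ioi.prod measurableSet_Ioo) fun p hp => ?_
    have hmem : polarCoord.symm p ∈ planeEquiv ⁻¹' A ↔ p.1 < 1 ∧ circlePoint p.2 ∈ s := by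
      rw [← smul_circlePoint_mem_iff hp.1]
      have : planeEquiv (polarCoord.symm p) = p.1 • (circlePoint p.2 : Plane) := by
        rw [planeEquiv_apply, coe_circlePoint]
        ext i
        fin_cases i <;> simp
      rw [← this]; rfl
    by_cases hmA : polarCoord.symm p ∈ planeEquiv ⁻¹' A
    · obtain ⟨ha, hb⟩ := hmem.1 hmA
      have hb' : p.2 ∈ circlePoint ⁻¹' s := hb
      have ha' : p.1 ∈ Set.Iio (1 : ℝ) := ha
      beta_reduce
      rw [Set.indicator_of_mem hmA, Set.indicator_of_mem hb', Set.indicator_of_mem ha']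
      rfl
    · beta_reduce
      rw [Set.indicator_of_notMem hmA, smul_zero]
      by_cases ha : p.1 < 1 <;> by_cases hb : circlePoint p.2 ∈ s
      · exact absurd (hmem.2 ⟨ha, hb⟩) hmA
      all_goals simp [ha, hb]
  rw [h2, Measure.volume_eq_prod, ← Measure.prod_restrict, lintegral_prod_mul]
  · rw [lintegral_indicator_one (hcm hs), setLIntegral_indicator measurableSet_Iio, Set.inter_comm,
      Set.Ioi_inter_Iio, Measure.restrict_congr_set Ioo_ae_eq_Ioc]
    have hint : IntegrableOn (fun x : ℝ => x) (Set.Ioc 0 1) := continuous_id.integrableOn_Ioc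
    have : ∫⁻ x in Set.Ioc (0 : ℝ) 1, ENNReal.ofReal x = ENNReal.ofReal (1 / 2) := by
      rw [← ofReal_integral_eq_lintegral_ofReal hint
        ((ae_restrict_mem measurableSet_Ioc).mono fun t ht => ht.1.le),
        ← intervalIntegral.integral_of_le zero_le_one]
      simp
    rw [this, ← mul_assoc]
    -- The dimension factor in the definition of `toSphere` cancels the radial integral `1/2`.
    have h3 : ((Module.finrank ℝ Plane : ℕ) : ℝ≥0∞) * ENNReal.ofReal (1 / 2) = 1 := by
      rw [finrank_euclideanSpace_fin, ← ENNReal.ofReal_natCast, ← ENNReal.ofReal_mul (by positivity)]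
      norm_num
    rw [h3, one_mul]
  · exact (ENNReal.measurable_ofReal.indicator measurableSet_Iio).aemeasurable
  · exact (measurable_one.indicator (hcm hs)).aemeasurable

end CircleExtension

/-! ### The square of the extension as a Fourier transform -/

theorem volume_prod_diagonal : volume {p : ℝ × ℝ | p.1 = p.2} = 0 := by
  have hm : MeasurableSet {p : ℝ × ℝ | p.1 = p.2} := measurableSet_eq_fun (by fun_prop) (by fun_prop)
  rw [Measure.volume_eq_prod, Measure.measure_prod_null hm]
  refine Filter.Eventually.of_forall fun x => ?_
  have : Prod.mk x ⁻¹' {p : ℝ × ℝ | p.1 = p.2} = {x} := by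
    ext y; simp [eq_comm]
  beta_reduce
  rw [this]
  simp

/-- The product integrand is symmetric and the diagonal is null. Passing to ordered pairs is what
makes the sum map injective later. -/
theorem sq_integral_eq_two_mul_setIntegral {k : ℝ → ℂ} (hk : Integrable k) :
    (∫ θ, k θ) ^ 2 = 2 * ∫ p in {p : ℝ × ℝ | p.1 < p.2}, k p.1 * k p.2 := by
  have hK : Integrable (fun p : ℝ × ℝ => k p.1 * k p.2) := hk.mul_prod hk
  have hm : MeasurableSet {p : ℝ × ℝ | p.1 < p.2} := measurableSet_lt (by fun_prop) (by fun_prop)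
  have h1 : (∫ θ, k θ) ^ 2 = ∫ p : ℝ × ℝ, k p.1 * k p.2 := by
    rw [Measure.volume_eq_prod, integral_prod_mul, sq]
  rw [h1, ← integral_add_compl hm hK, two_mul]
  congr 1
  have h2 : ({p : ℝ × ℝ | p.1 < p.2}ᶜ : Set (ℝ × ℝ)) =ᵐ[volume] {p : ℝ × ℝ | p.2 < p.1} := by
    have h0 : ∀ᵐ p : ℝ × ℝ, ¬ p.1 = p.2 := by
      rw [ae_iff]; simpa using volume_prod_diagonal
    rw [Filter.eventuallyEq_set]
    filter_upwards [h0] with p hp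
    simp only [Set.mem_compl_iff, Set.mem_ofPred_eq, not_lt]
    exact ⟨fun h => lt_of_le_of_ne h (Ne.symm hp), le_of_lt⟩
  rw [setIntegral_congr_set h2]
  have h3 := (Measure.measurePreserving_swap (μ := (volume : Measure ℝ)) (ν := (volume : Measure ℝ))).setIntegral_preimage_emb
    (MeasurableEquiv.prodComm.measurableEmbedding) (fun p : ℝ × ℝ => k p.1 * k p.2) {p : ℝ × ℝ | p.1 < p.2}
  rw [← Measure.volume_eq_prod] at h3
  rw [← h3]
  simp only [Prod.fst_swap, Prod.snd_swap]
  have h4 : (Prod.swap ⁻¹' {p : ℝ × ℝ | p.1 < p.2}) = {p : ℝ × ℝ | p.2 < p.1} := rfl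
  rw [h4]
  simp_rw [mul_comm]

namespace CircleExtension

/-- The coordinates of the sum of the points of the circle at two angles. -/
noncomputable def angleSum (p : ℝ × ℝ) : ℝ × ℝ :=
  (Real.cos p.1 + Real.cos p.2, Real.sin p.1 + Real.sin p.2)

theorem planeEquiv_angleSum (p : ℝ × ℝ) :
    planeEquiv (angleSum p) = (circlePoint p.1 : Plane) + (circlePoint p.2 : Plane) := by
  rw [planeEquiv_apply, coe_circlePoint, coe_circlePoint]
  ext i
  fin_cases i <;> simp [angleSum]

/-- The derivative of `angleSum`. -/
noncomputable def fderivAngleSum (p : ℝ × ℝ) : ℝ × ℝ →L[ℝ] ℝ × ℝ :=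
  (Matrix.toLin (.finTwoProd ℝ) (.finTwoProd ℝ)
    !![-Real.sin p.1, -Real.sin p.2; Real.cos p.1, Real.cos p.2]).toContinuousLinearMap

theorem hasFDerivAt_angleSum (p : ℝ × ℝ) : HasFDerivAt angleSum (fderivAngleSum p) p := by
  unfold fderivAngleSum
  rw [Matrix.toLin_finTwoProd_toContinuousLinearMap]
  exact HasFDerivAt.prodMk (𝕜 := ℝ)
    (((Real.hasDerivAt_cos p.1).comp_hasFDerivAt p hasFDerivAt_fst).add
      ((Real.hasDerivAt_cos p.2).comp_hasFDerivAt p hasFDerivAt_snd))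
    (((Real.hasDerivAt_sin p.1).comp_hasFDerivAt p hasFDerivAt_fst).add
      ((Real.hasDerivAt_sin p.2).comp_hasFDerivAt p hasFDerivAt_snd))

theorem det_fderivAngleSum (p : ℝ × ℝ) : (fderivAngleSum p).det = Real.sin (p.2 - p.1) := by
  unfold fderivAngleSum
  simp only [LinearMap.det_toContinuousLinearMap, LinearMap.det_toLin, Matrix.det_fin_two_of]
  rw [Real.sin_sub]
  ring

/-- The ordered pairs of angles in the open quarter arc starting at `α`. -/
def orderedPairs (α : ℝ) : Set (ℝ × ℝ) := {p | α < p.1 ∧ p.1 < p.2 ∧ p.2 < α + Real.pi / 2}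

theorem measurableSet_orderedPairs (α : ℝ) : MeasurableSet (orderedPairs α) := by
  have h1 : MeasurableSet {p : ℝ × ℝ | α < p.1} := measurableSet_lt (by fun_prop) (by fun_prop)
  have h2 : MeasurableSet {p : ℝ × ℝ | p.1 < p.2} := measurableSet_lt (by fun_prop) (by fun_prop)
  have h3 : MeasurableSet {p : ℝ × ℝ | p.2 < α + Real.pi / 2} :=
    measurableSet_lt (by fun_prop) (by fun_prop)
  exact h1.inter (h2.inter h3)

/-- With midpoint `m` and half-difference `u`, the sum is `2 cos u (cos m, sin m)`. On a quarter arc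
`0 < u < π/4`, so the length of the sum determines `u` and its direction determines `m`. -/
theorem injOn_angleSum (α : ℝ) : Set.InjOn angleSum (orderedPairs α) := by
  rintro ⟨a, b⟩ ⟨h1, h2, h3⟩ ⟨c, d⟩ ⟨k1, k2, k3⟩ h
  simp only at h1 h2 h3 k1 k2 k3
  have hpi := Real.pi_pos
  simp only [angleSum, Prod.mk.injEq] at h
  obtain ⟨hc, hs⟩ := h
  rw [Real.cos_add_cos, Real.cos_add_cos] at hc
  rw [Real.sin_add_sin, Real.sin_add_sin] at hs
  set m := (a + b) / 2 with hm
  set n := (c + d) / 2 with hn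
  have e1 : Real.cos ((a - b) / 2) = Real.cos ((b - a) / 2) := by
    rw [← Real.cos_neg]; congr 1; ring
  have e2 : Real.cos ((c - d) / 2) = Real.cos ((d - c) / 2) := by
    rw [← Real.cos_neg]; congr 1; ring
  rw [e1, e2] at hc
  rw [show Real.cos ((a - b) / 2) = Real.cos ((b - a) / 2) from e1,
    show Real.cos ((c - d) / 2) = Real.cos ((d - c) / 2) from e2] at hs
  set u := (b - a) / 2 with hu
  set v := (d - c) / 2 with hv
  have hup : 0 < Real.cos u := Real.cos_pos_of_mem_Ioo ⟨by linarith, by linarith⟩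
  have hvp : 0 < Real.cos v := Real.cos_pos_of_mem_Ioo ⟨by linarith, by linarith⟩
  have hsq : Real.cos u ^ 2 = Real.cos v ^ 2 := by
    have g1 := Real.sin_sq_add_cos_sq m
    have g2 := Real.sin_sq_add_cos_sq n
    have g3 : (2 * Real.cos m * Real.cos u) ^ 2 + (2 * Real.sin m * Real.cos u) ^ 2 =
      (2 * Real.cos n * Real.cos v) ^ 2 + (2 * Real.sin n * Real.cos v) ^ 2 := by rw [hc, hs]
    linear_combination g3 / 4 - Real.cos u ^ 2 * g1 + Real.cos v ^ 2 * g2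
  have hcos : Real.cos u = Real.cos v := by
    rwa [sq_eq_sq₀ hup.le hvp.le] at hsq
  have huv : u = v := Real.injOn_cos ⟨by linarith, by linarith⟩ ⟨by linarith, by linarith⟩ hcos
  rw [hcos] at hc hs
  have hc' : Real.cos m = Real.cos n := by
    have := mul_right_cancel₀ hvp.ne' hc
    linarith
  have hs' : Real.sin m = Real.sin n := by
    have := mul_right_cancel₀ hvp.ne' hs
    linarith
  have h1 : Real.cos (m - n) = 1 := by
    rw [Real.cos_sub, hc', hs']
    linear_combination Real.sin_sq_add_cos_sq n
  have hmn : m - n = 0 :=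
    (Real.cos_eq_one_iff_of_lt_of_lt (by linarith) (by linarith)).mp h1
  ext
  · simp only; linarith
  · simp only; linarith

theorem sin_pos_of_mem_orderedPairs {α : ℝ} {p : ℝ × ℝ} (hp : p ∈ orderedPairs α) :
    0 < Real.sin (p.2 - p.1) := by
  obtain ⟨h1, h2, h3⟩ := hp
  exact Real.sin_pos_of_pos_of_lt_pi (by linarith) (by linarith [Real.pi_pos])

/-- The extension operator restricted to the quarter arc starting at `α`, in the angle variable. -/
noncomputable def arcExtension (α : ℝ) (w : ℝ → ℂ) (ξ : Plane) : ℂ :=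
  ∫ θ in Set.Ioo α (α + Real.pi / 2),
    Complex.exp (-Complex.I * ((inner ℝ ξ (circlePoint θ : Plane) : ℝ) : ℂ)) * w θ

theorem norm_exp_neg_I_mul (x : ℝ) : ‖Complex.exp (-Complex.I * (x : ℂ))‖ = 1 := by
  rw [show -Complex.I * (x : ℂ) = ((-x : ℝ) : ℂ) * Complex.I by push_cast; ring]
  exact Complex.norm_exp_ofReal_mul_I _

theorem arcExtension_sq {α : ℝ} {w : ℝ → ℂ} (hw : IntegrableOn w (Set.Ioo α (α + Real.pi / 2)))
    (ξ : Plane) :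
    arcExtension α w ξ ^ 2 = 2 * ∫ p in orderedPairs α,
      Complex.exp (-Complex.I * ((inner ℝ ξ ((circlePoint p.1 : Plane) + circlePoint p.2) : ℝ) : ℂ)) *
        (w p.1 * w p.2) := by
  set I := Set.Ioo α (α + Real.pi / 2) with hI
  set k : ℝ → ℂ := I.indicator fun θ =>
    Complex.exp (-Complex.I * ((inner ℝ ξ (circlePoint θ : Plane) : ℝ) : ℂ)) * w θ with hk
  have hcont : Continuous fun θ : ℝ =>
      Complex.exp (-Complex.I * ((inner ℝ ξ (circlePoint θ : Plane) : ℝ) : ℂ)) := by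
    have := continuous_subtype_val.comp continuous_circlePoint
    exact Complex.continuous_exp.comp (continuous_const.mul
      (Complex.continuous_ofReal.comp (continuous_const.inner this)))
  have hki : Integrable k := by
    rw [hk, integrable_indicator_iff measurableSet_Ioo]
    refine Integrable.bdd_mul (c := 1) hw hcont.aestronglyMeasurable ?_
    exact Filter.Eventually.of_forall fun θ => (norm_exp_neg_I_mul _).le
  have h1 : arcExtension α w ξ = ∫ θ, k θ := by
    rw [hk, integral_indicator measurableSet_Ioo]; rfl
  rw [h1, sq_integral_eq_two_mul_setIntegral hki]
  congr 1
  have hm : MeasurableSet {p : ℝ × ℝ | p.1 < p.2} := measurableSet_lt (by fun_prop) (by fun_prop)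
  rw [← integral_indicator hm, ← integral_indicator (measurableSet_orderedPairs α)]
  congr 1
  ext p
  by_cases hp : p ∈ orderedPairs α
  · obtain ⟨a1, a2, a3⟩ := hp
    have b1 : p.1 ∈ I := ⟨a1, a2.trans a3⟩
    have b2 : p.2 ∈ I := ⟨a1.trans a2, a3⟩
    have b3 : p ∈ {p : ℝ × ℝ | p.1 < p.2} := a2
    rw [Set.indicator_of_mem b3, Set.indicator_of_mem (show p ∈ orderedPairs α from ⟨a1, a2, a3⟩), hk,
      Set.indicator_of_mem b1, Set.indicator_of_mem b2, inner_add_right]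
    push_cast
    rw [mul_add, Complex.exp_add]
    ring
  · rw [Set.indicator_of_notMem hp]
    by_cases h2 : p.1 < p.2
    · have b3 : p ∈ {p : ℝ × ℝ | p.1 < p.2} := h2
      rw [Set.indicator_of_mem b3, mul_eq_zero]
      by_contra hc
      push Not at hc
      have c1 : p.1 ∈ I := Set.mem_of_indicator_ne_zero hc.1
      have c2 : p.2 ∈ I := Set.mem_of_indicator_ne_zero hc.2
      exact hp ⟨c1.1, h2, c2.2⟩
    · exact Set.indicator_of_notMem (s := {p : ℝ × ℝ | p.1 < p.2}) h2 _

/-- The density of the convolution square of the arc measure weighted by `w`. -/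
theorem exists_convolution_density {α : ℝ} {w : ℝ → ℂ}
    (hw : IntegrableOn w (Set.Ioo α (α + Real.pi / 2))) :
    ∃ F : Plane → ℂ, Integrable F ∧
      (∀ ξ, arcExtension α w ξ ^ 2 =
        2 * ∫ v, Complex.exp (-Complex.I * ((inner ℝ ξ v : ℝ) : ℂ)) * F v) ∧
      ∫⁻ v, ‖F v‖ₑ ^ (3 / 2 : ℝ) = ∫⁻ p in orderedPairs α, ‖w p.1‖ₑ ^ (3 / 2 : ℝ) *
        ‖w p.2‖ₑ ^ (3 / 2 : ℝ) * ENNReal.ofReal (Real.sin (p.2 - p.1) ^ (-(1 / 2) : ℝ)) := by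
  set U := orderedPairs α with hU
  have hUm : MeasurableSet U := measurableSet_orderedPairs α
  have hinj := injOn_angleSum α
  have hderiv : ∀ p ∈ U, HasFDerivWithinAt angleSum (fderivAngleSum p) U p :=
    fun p _ => (hasFDerivAt_angleSum p).hasFDerivWithinAt
  set D := angleSum '' U with hD
  have hDm : MeasurableSet D := measurable_image_of_fderivWithin hUm hderiv hinj
  -- Dividing by the Jacobian makes the transported density integrate back to `w p.1 * w p.2`.
  set q : ℝ × ℝ → ℂ := fun p => w p.1 * w p.2 / (Real.sin (p.2 - p.1) : ℂ) with hq
  set F0 : ℝ × ℝ → ℂ := fun u => q (Function.invFunOn angleSum U u) with hF0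
  have hF0q : ∀ p ∈ U, F0 (angleSum p) = q p := by
    intro p hp
    have := hinj.leftInvOn_invFunOn hp
    exact congrArg q this
  have hdet : ∀ p ∈ U, |(fderivAngleSum p).det| = Real.sin (p.2 - p.1) := by
    intro p hp
    rw [det_fderivAngleSum, abs_of_pos (sin_pos_of_mem_orderedPairs hp)]
  have hmulq : ∀ p ∈ U, (Real.sin (p.2 - p.1) : ℂ) * q p = w p.1 * w p.2 := by
    intro p hp
    have : (Real.sin (p.2 - p.1) : ℂ) ≠ 0 := by
      exact_mod_cast (sin_pos_of_mem_orderedPairs hp).ne'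
    simp only [hq]
    rw [mul_div_cancel₀ _ this]
  have hww : IntegrableOn (fun p : ℝ × ℝ => w p.1 * w p.2) U := by
    have h1 : IntegrableOn (fun p : ℝ × ℝ => w p.1 * w p.2)
        (Set.Ioo α (α + Real.pi / 2) ×ˢ Set.Ioo α (α + Real.pi / 2)) := by
      rw [IntegrableOn, Measure.volume_eq_prod, ← Measure.prod_restrict]
      exact Integrable.mul_prod hw hw
    refine h1.mono_set ?_
    rintro p ⟨a1, a2, a3⟩
    exact ⟨⟨a1, a2.trans a3⟩, ⟨a1.trans a2, a3⟩⟩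
  have hF0i : IntegrableOn F0 D := by
    rw [integrableOn_image_iff_integrableOn_abs_det_fderiv_smul volume hUm hderiv hinj]
    refine hww.congr_fun (fun p hp => ?_) hUm
    beta_reduce
    rw [hdet p hp, hF0q p hp, Complex.real_smul, hmulq p hp]
  have hinvm := measurePreserving_planeEquiv.symm
  refine ⟨fun v => D.indicator F0 (planeEquiv.symm v), ?_, ?_, ?_⟩
  · exact (hinvm.integrable_comp_emb planeEquiv.symm.measurableEmbedding).mpr
      ((integrable_indicator_iff hDm).mpr hF0i)
  · intro ξ
    rw [arcExtension_sq hw]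
    congr 1
    rw [← measurePreserving_planeEquiv.integral_comp planeEquiv.measurableEmbedding]
    simp only [MeasurableEquiv.symm_apply_apply]
    have h1 : ∀ u, Complex.exp (-Complex.I * ((inner ℝ ξ (planeEquiv u) : ℝ) : ℂ)) * D.indicator F0 u =
        D.indicator (fun u => Complex.exp (-Complex.I * ((inner ℝ ξ (planeEquiv u) : ℝ) : ℂ)) * F0 u) u := by
      intro u
      by_cases hu : u ∈ D <;> simp [hu]
    simp_rw [h1]
    rw [integral_indicator hDm, integral_image_eq_integral_abs_det_fderiv_smul volume hUm hderiv hinj]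
    refine setIntegral_congr_fun hUm fun p hp => ?_
    beta_reduce
    rw [hdet p hp, hF0q p hp, Complex.real_smul, planeEquiv_angleSum, ← hmulq p hp]
    ring
  · have h1 := measurePreserving_planeEquiv.lintegral_comp_emb planeEquiv.measurableEmbedding
      (fun v => ‖D.indicator F0 (planeEquiv.symm v)‖ₑ ^ (3 / 2 : ℝ))
    rw [← h1]
    simp only [MeasurableEquiv.symm_apply_apply]
    have h2 : ∀ u, ‖D.indicator F0 u‖ₑ ^ (3 / 2 : ℝ) = D.indicator (fun u => ‖F0 u‖ₑ ^ (3 / 2 : ℝ)) u := by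
      intro u
      by_cases hu : u ∈ D <;> simp [hu]
    simp_rw [h2]
    rw [lintegral_indicator hDm, lintegral_image_eq_lintegral_abs_det_fderiv_mul volume hUm hderiv hinj]
    refine setLIntegral_congr_fun hUm fun p hp => ?_
    have hs := sin_pos_of_mem_orderedPairs hp
    rw [hdet p hp, hF0q p hp]
    simp only [hq]
    rw [← ofReal_norm, norm_div, norm_mul, Complex.norm_real, Real.norm_of_nonneg hs.le,
      ← ofReal_norm, ← ofReal_norm, ENNReal.ofReal_rpow_of_nonneg (by positivity) (by norm_num),
      ENNReal.ofReal_rpow_of_nonneg (by positivity) (by norm_num),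
      ENNReal.ofReal_rpow_of_nonneg (by positivity) (by norm_num),
      ← ENNReal.ofReal_mul (by positivity), ← ENNReal.ofReal_mul (by positivity),
      ← ENNReal.ofReal_mul (by positivity)]
    congr 1
    rw [Real.div_rpow (by positivity) hs.le, Real.mul_rpow (by positivity) (by positivity)]
    -- The density contributes the Jacobian to the power `-3/2` and the change of variables one
    -- power back.
    have : Real.sin (p.2 - p.1) ^ (-(1 / 2) : ℝ) = Real.sin (p.2 - p.1) / Real.sin (p.2 - p.1) ^ (3 / 2 : ℝ) := by
      rw [eq_div_iff (by positivity), ← Real.rpow_add hs]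
      norm_num
    rw [this]
    ring

open FourierTransform in
theorem integral_exp_eq_fourier (F : Plane → ℂ) (ξ : Plane) :
    ∫ v, Complex.exp (-Complex.I * ((inner ℝ ξ v : ℝ) : ℂ)) * F v =
      𝓕 F ((2 * Real.pi)⁻¹ • ξ) := by
  rw [Real.fourier_eq']
  congr 1; ext v
  rw [inner_smul_right, smul_eq_mul, real_inner_comm]
  congr 2
  have := Real.pi_ne_zero
  push_cast
  field_simp

theorem lintegral_enorm_arcExtension_le {α : ℝ} {w : ℝ → ℂ}
    (hw : IntegrableOn w (Set.Ioo α (α + Real.pi / 2))) {B : ℝ} (hB : 0 < B)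
    (h : ∫⁻ p in orderedPairs α, ‖w p.1‖ₑ ^ (3 / 2 : ℝ) *
        ‖w p.2‖ₑ ^ (3 / 2 : ℝ) * ENNReal.ofReal (Real.sin (p.2 - p.1) ^ (-(1 / 2) : ℝ))
          ≤ ENNReal.ofReal B) :
    ∫⁻ ξ, ‖arcExtension α w ξ‖ₑ ^ 6 ≤ ENNReal.ofReal (768 * Real.pi ^ 2 * B ^ 2) := by
  obtain ⟨F, hFi, hF, hFn⟩ := exists_convolution_density hw
  rw [← hFn] at h
  have hHY := lintegral_enorm_fourier_cube_le hFi hB h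
  have hpi := Real.pi_pos
  have h1 : ∀ ξ, ‖arcExtension α w ξ‖ₑ ^ 6 =
      8 * ‖FourierTransform.fourier F ((2 * Real.pi)⁻¹ • ξ)‖ₑ ^ 3 := by
    intro ξ
    have := hF ξ
    rw [integral_exp_eq_fourier] at this
    rw [show ‖arcExtension α w ξ‖ₑ ^ 6 = (‖arcExtension α w ξ‖ₑ ^ 2) ^ 3 by rw [← pow_mul], ← enorm_pow, this, enorm_mul, mul_pow]
    congr 1
    rw [← ofReal_norm]
    norm_num
  simp_rw [h1]
  rw [lintegral_const_mul' _ _ (by simp)]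
  have hne : (2 * Real.pi)⁻¹ ≠ 0 := by positivity
  have h2 : ∫⁻ ξ, ‖FourierTransform.fourier F ((2 * Real.pi)⁻¹ • ξ)‖ₑ ^ 3 =
      ENNReal.ofReal ((2 * Real.pi) ^ 2) * ∫⁻ ξ, ‖FourierTransform.fourier F ξ‖ₑ ^ 3 := by
    have hemb : MeasurableEmbedding fun ξ : Plane => (2 * Real.pi)⁻¹ • ξ :=
      (Homeomorph.smulOfNeZero _ hne).measurableEmbedding
    rw [← hemb.lintegral_map (fun ξ => ‖FourierTransform.fourier F ξ‖ₑ ^ 3),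
      Measure.map_addHaar_smul _ hne, lintegral_smul_measure, finrank_euclideanSpace_fin, smul_eq_mul]
    congr 2
    rw [inv_pow, inv_inv, abs_of_pos (by positivity)]
  rw [h2]
  -- The constant is `8 · (2π)² · 24`: the factor `2` cubed, the dilation between the two Fourier
  -- normalizations, and Hausdorff–Young.
  calc _ ≤ 8 * (ENNReal.ofReal ((2 * Real.pi) ^ 2) * ENNReal.ofReal (24 * B ^ 2)) := by gcongr
    _ = _ := by
      rw [show (8 : ℝ≥0∞) = ENNReal.ofReal 8 by simp, ← ENNReal.ofReal_mul (by positivity),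
        ← ENNReal.ofReal_mul (by positivity)]
      congr 1; ring

/-! ### Caps in the angle variable -/

theorem inner_circlePoint (θ φ : ℝ) :
    inner ℝ (circlePoint φ : Plane) (circlePoint θ : Plane) = Real.cos (φ - θ) := by
  simp only [coe_circlePoint, PiLp.inner_apply, Fin.sum_univ_two, Real.cos_sub]
  simp
  ring

theorem norm_starProjection_circlePoint (θ φ : ℝ) :
    ‖((Submodule.span ℝ {(circlePoint θ : Plane)})ᗮ).starProjection (circlePoint φ : Plane)‖ =
      |Real.sin (φ - θ)| := by
  have hn : ‖(circlePoint θ : Plane)‖ = 1 := norm_eq_of_mem_sphere _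
  have hn' : ‖(circlePoint φ : Plane)‖ = 1 := norm_eq_of_mem_sphere _
  have h1 : ((Submodule.span ℝ {(circlePoint θ : Plane)})ᗮ).starProjection (circlePoint φ : Plane) =
      (circlePoint φ : Plane) - Real.cos (φ - θ) • (circlePoint θ : Plane) := by
    rw [Submodule.starProjection_orthogonal_val, Submodule.starProjection_unit_singleton ℝ hn,
      real_inner_comm, inner_circlePoint]
  rw [h1, ← abs_norm, ← sq_eq_sq_iff_abs_eq_abs, norm_sub_sq_real, inner_smul_right,
    inner_circlePoint, norm_smul, hn, hn', Real.norm_eq_abs, mul_one, sq_abs]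
  linear_combination -Real.sin_sq_add_cos_sq (φ - θ)

theorem circlePoint_mem_cap_iff {θ φ r : ℝ} :
    circlePoint φ ∈ cap (circlePoint θ) r ↔ 0 < Real.cos (φ - θ) ∧ |Real.sin (φ - θ)| < r := by
  unfold cap
  rw [Set.mem_ofPred_eq, inner_circlePoint, norm_starProjection_circlePoint]

theorem measurableSet_cap (z : S1) (r : ℝ) : MeasurableSet (cap z r) := by
  have h1 : IsOpen {y : S1 | 0 < inner ℝ (y : Plane) (z : Plane)} :=
    isOpen_lt continuous_const (continuous_subtype_val.inner continuous_const)
  have h2 : IsOpen {y : S1 | ‖((Submodule.span ℝ {(z : Plane)})ᗮ).starProjection (y : Plane)‖ < r} :=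
    isOpen_lt ((ContinuousLinearMap.continuous _).comp continuous_subtype_val).norm continuous_const
  exact (h1.inter h2).measurableSet

theorem abs_lt_of_abs_sin_lt {x r : ℝ} (hx : |x| ≤ Real.pi / 2) (h : |Real.sin x| < r) :
    |x| < 2 * r := by
  have hpi := Real.pi_pos
  have h1 := Real.mul_le_sin (abs_nonneg x) hx
  have h2 : Real.sin |x| ≤ |Real.sin x| := by
    rcases abs_cases x with ⟨h, _⟩ | ⟨h, _⟩
    · rw [h]; exact le_abs_self _
    · rw [h, Real.sin_neg]; exact neg_le_abs _
  have h3 : 2 / Real.pi * |x| < r := lt_of_le_of_lt (h1.trans h2) h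
  rw [div_mul_eq_mul_div, div_lt_iff₀ hpi] at h3
  have h0 : 0 ≤ |Real.sin x| := abs_nonneg _
  nlinarith [Real.pi_lt_four]

/-- Two angles in `(-π, π)` may differ by almost a full turn, so a cap can wrap around the cut at
`π`; hence three windows. -/
theorem angle_mem_of_mem_cap {x r : ℝ} (h1 : -(2 * Real.pi) < x) (h2 : x < 2 * Real.pi)
    (hc : 0 < Real.cos x) (hs : |Real.sin x| < r) :
    |x| < 2 * r ∨ |x - 2 * Real.pi| < 2 * r ∨ |x + 2 * Real.pi| < 2 * r := by
  have hpi := Real.pi_pos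
  by_cases ha : |x| ≤ Real.pi / 2
  · exact Or.inl (abs_lt_of_abs_sin_lt ha hs)
  · right
    push Not at ha
    have hb : Real.pi + Real.pi / 2 < |x| := by
      by_contra hcon
      push Not at hcon
      have := Real.cos_nonpos_of_pi_div_two_le_of_le ha.le hcon
      rw [Real.cos_abs] at this
      linarith
    rcases abs_cases x with ⟨h, _⟩ | ⟨h, _⟩
    · left
      apply abs_lt_of_abs_sin_lt
      · rw [abs_le]; constructor <;> linarith
      · rwa [Real.sin_sub_two_pi]
    · right
      apply abs_lt_of_abs_sin_lt
      · rw [abs_le]; constructor <;> linarith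
      · rwa [Real.sin_add_two_pi]

instance : IsFiniteMeasure σ := by
  unfold σ; infer_instance

theorem σ_real_cap_le {θ r : ℝ} (hθ : θ ∈ Set.Ioo (-Real.pi) Real.pi) (hr : 0 < r) :
    σ.real (cap (circlePoint θ) r) ≤ 12 * r := by
  have hv : ∀ c : ℝ, volume {φ : ℝ | |φ - c| < 2 * r} = ENNReal.ofReal (4 * r) := by
    intro c
    have : {φ : ℝ | |φ - c| < 2 * r} = Metric.ball c (2 * r) := by
      ext φ; simp [Real.dist_eq]
    rw [this, Real.volume_ball]
    congr 1; ring
  have h : σ (cap (circlePoint θ) r) ≤ ENNReal.ofReal (12 * r) := by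
    rw [σ_eq_map, Measure.map_apply continuous_circlePoint.measurable (measurableSet_cap _ _),
      Measure.restrict_apply (continuous_circlePoint.measurable (measurableSet_cap _ _))]
    have hsub : circlePoint ⁻¹' cap (circlePoint θ) r ∩ Set.Ioo (-Real.pi) Real.pi ⊆
        {φ | |φ - θ| < 2 * r} ∪ ({φ | |φ - (θ + 2 * Real.pi)| < 2 * r} ∪
          {φ | |φ - (θ - 2 * Real.pi)| < 2 * r}) := by
      rintro φ ⟨hφ, hφ'⟩
      obtain ⟨hc, hs⟩ := circlePoint_mem_cap_iff.mp hφ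
      rcases angle_mem_of_mem_cap (by linarith [hφ'.1, hθ.2]) (by linarith [hφ'.2, hθ.1]) hc hs with
        h | h | h
      · exact Or.inl h
      · refine Or.inr (Or.inl ?_)
        rw [Set.mem_ofPred_eq, show φ - (θ + 2 * Real.pi) = φ - θ - 2 * Real.pi by ring]
        exact h
      · refine Or.inr (Or.inr ?_)
        rw [Set.mem_ofPred_eq, show φ - (θ - 2 * Real.pi) = φ - θ + 2 * Real.pi by ring]
        exact h
    refine (measure_mono hsub).trans ((measure_union_le _ _).trans
      ((add_le_add le_rfl (measure_union_le _ _)).trans (le_of_eq ?_)))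
    rw [hv, hv, hv, ← ENNReal.ofReal_add (by positivity) (by positivity),
      ← ENNReal.ofReal_add (by positivity) (by positivity)]
    congr 1; ring
  exact ENNReal.toReal_le_of_le_ofReal (by positivity) h

/-- Within a quarter turn the sine is automatically below `1`, so truncating the radius at `1` loses
nothing. -/
theorem circlePoint_mem_cap_of_abs_lt {θ φ S : ℝ} (h1 : |φ - θ| < S) (h2 : |φ - θ| < Real.pi / 2) :
    circlePoint φ ∈ cap (circlePoint θ) (min S 1) := by
  rw [circlePoint_mem_cap_iff]
  have hc : 0 < Real.cos (φ - θ) := Real.cos_pos_of_mem_Ioo (abs_lt.mp h2)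
  refine ⟨hc, lt_min ?_ ?_⟩
  · exact lt_of_le_of_lt Real.abs_sin_le_abs h1
  · rw [← sq_lt_one_iff_abs_lt_one]
    nlinarith [Real.sin_sq_add_cos_sq (φ - θ)]

/-! ### From non-concentration to a small extension -/

/-- The choice `M = ρ^{-4}`, `X = ρ^8` balances the near and far terms: `(M X)^{1/4} = ρ` and
`M^{-1/4} = ρ`. -/
theorem lintegral_enorm_arcExtension_le_of_not_concentrated {α : ℝ} {w : ℝ → ℂ} (hwm : Measurable w)
    (hw : ∫⁻ θ in Set.Ioo α (α + Real.pi / 2), ‖w θ‖ₑ ^ 2 ≤ 1) {ρ : ℝ} (hρ : 0 < ρ)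
    (hconc : ∀ θ ∈ Set.Ioo α (α + Real.pi / 2), w θ ≠ 0 →
      ∫⁻ φ in Set.Ioo α (α + Real.pi / 2) ∩ {φ | |φ - θ| < (ρ ^ 4)⁻¹ / ‖w θ‖ ^ 2 ∧ ‖w φ‖ ≤ ‖w θ‖},
        ‖w φ‖ₑ ^ 2 ≤ ENNReal.ofReal (ρ ^ 8)) :
    ∫⁻ ξ, ‖arcExtension α w ξ‖ₑ ^ 6 ≤ ENNReal.ofReal (768 * Real.pi ^ 2 * (32 * ρ) ^ 2) := by
  set I := Set.Ioo α (α + Real.pi / 2) with hI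
  have hIm : MeasurableSet I := measurableSet_Ioo
  have hwi : IntegrableOn w I := by
    have h2 : MemLp w 2 (volume.restrict I) := by
      refine ⟨hwm.aestronglyMeasurable, ?_⟩
      have := eLpNorm_nnreal_pow_eq_lintegral (f := w) (μ := volume.restrict I) (p := 2) (by norm_num)
      have h3 : eLpNorm w 2 (volume.restrict I) ^ 2 ≤ 1 := by
        refine le_trans (le_of_eq ?_) hw
        simpa using this
      have h4 : eLpNorm w 2 (volume.restrict I) ≤ 1 := by
        by_contra hc
        push Not at hc
        exact absurd h3 (not_le.mpr (one_lt_pow₀ hc two_ne_zero))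
      exact lt_of_le_of_lt h4 ENNReal.one_lt_top
    exact h2.integrable (by norm_num)
  apply lintegral_enorm_arcExtension_le hwi (by positivity)
  set b : ℝ → ℝ≥0∞ := I.indicator fun θ => ‖w θ‖ₑ with hb
  have hbm : Measurable b := Measurable.indicator (by fun_prop) hIm
  have hbI : ∀ θ ∈ I, b θ = ‖w θ‖ₑ := fun θ hθ => Set.indicator_of_mem hθ _
  have hbsq : (fun θ => b θ ^ 2) = I.indicator fun θ => ‖w θ‖ₑ ^ 2 := by
    ext θ
    by_cases hθ : θ ∈ I <;> simp [hb, hθ]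
  have key := lintegral_pair_le (b := b) hbm (fun θ => by
      by_cases hθ : θ ∈ I <;> simp [hb, hθ])
    (by rw [hbsq, lintegral_indicator hIm]; exact hw) (M := (ρ ^ 4)⁻¹) (X := ρ ^ 8)
    (by positivity) (by positivity) (by
      intro θ hθ0
      have hθ : θ ∈ I := Set.mem_of_indicator_ne_zero hθ0
      have hbθ := hbI θ hθ
      have hw0 : w θ ≠ 0 := by
        intro h0
        rw [hbθ, h0] at hθ0
        simp at hθ0
      refine le_trans ?_ (hconc θ hθ hw0)
      rw [hbsq, setLIntegral_indicator hIm, hbθ]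
      apply lintegral_mono_set
      rintro φ ⟨hφ, h1, h2⟩
      refine ⟨hφ, by simpa using h1, ?_⟩
      rw [hbI φ hφ, enorm_le_iff_norm_le] at h2
      exact h2)
  have hM : 2 * (6 ^ (3 / 4 : ℝ) * ((ρ ^ 4)⁻¹ * ρ ^ 8) ^ (1 / 4 : ℝ) + (2 / (ρ ^ 4)⁻¹) ^ (1 / 4 : ℝ))
      ≤ 16 * ρ := by
    have e1 : (ρ ^ 4)⁻¹ * ρ ^ 8 = ρ ^ 4 := by field_simp
    have e2 : (ρ ^ 4) ^ (1 / 4 : ℝ) = ρ := by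
      rw [← Real.rpow_natCast, ← Real.rpow_mul hρ.le]; norm_num
    have e3 : (6 : ℝ) ^ (3 / 4 : ℝ) ≤ 6 ^ (1 : ℝ) :=
      Real.rpow_le_rpow_of_exponent_le (by norm_num) (by norm_num)
    have e4 : (2 : ℝ) ^ (1 / 4 : ℝ) ≤ 2 ^ (1 : ℝ) :=
      Real.rpow_le_rpow_of_exponent_le (by norm_num) (by norm_num)
    rw [div_inv_eq_mul, e1, Real.mul_rpow (by norm_num) (by positivity), e2]
    rw [Real.rpow_one] at e3 e4
    nlinarith
  have key2 := key.trans (ENNReal.ofReal_le_ofReal hM)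
  set K : ℝ × ℝ → ℝ≥0∞ := fun p => b p.1 ^ (3 / 2 : ℝ) * b p.2 ^ (3 / 2 : ℝ) *
      ENNReal.ofReal (|p.2 - p.1| ^ (-(1 / 2) : ℝ)) with hK
  have hKm : Measurable K := by simp only [hK]; fun_prop
  have hprod : ∫⁻ p, K p = ∫⁻ θ, ∫⁻ φ, K (θ, φ) := by
    rw [Measure.volume_eq_prod, lintegral_prod _ hKm.aemeasurable]
  calc _ ≤ ∫⁻ p in orderedPairs α, 2 * K p := by
        apply setLIntegral_mono' (measurableSet_orderedPairs α)
        rintro p ⟨a1, a2, a3⟩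
        have b1 : p.1 ∈ I := ⟨a1, a2.trans a3⟩
        have b2 : p.2 ∈ I := ⟨a1.trans a2, a3⟩
        have hpi := Real.pi_pos
        have hx : 0 < p.2 - p.1 := by linarith
        simp only [hK]
        rw [hbI _ b1, hbI _ b2, mul_left_comm]
        gcongr
        rw [show (2 : ℝ≥0∞) = ENNReal.ofReal 2 by simp, ← ENNReal.ofReal_mul (by norm_num), abs_of_pos hx]
        apply ENNReal.ofReal_le_ofReal
        -- Jordan's inequality, available because angles in a quarter arc differ by at most `π/2`,
        -- replaces the Jacobian by the distance at the cost of `4^{1/2} = 2`.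
        have h1 := Real.mul_le_sin hx.le (by linarith)
        have h2 : (p.2 - p.1) / 4 ≤ Real.sin (p.2 - p.1) := by
          refine le_trans ?_ h1
          rw [div_mul_eq_mul_div, div_le_div_iff₀ (by norm_num) hpi]
          nlinarith [Real.pi_lt_four]
        calc _ ≤ ((p.2 - p.1) / 4) ^ (-(1 / 2) : ℝ) :=
              Real.rpow_le_rpow_of_nonpos (by positivity) h2 (by norm_num)
          _ = _ := by
              rw [Real.div_rpow hx.le (by norm_num)]
              have : (4 : ℝ) ^ (-(1 / 2) : ℝ) = 1 / 2 := by
                rw [show (4 : ℝ) = 2 ^ (2 : ℝ) by norm_num, ← Real.rpow_mul (by norm_num)]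
                norm_num
              rw [this]; ring
    _ ≤ ∫⁻ p, 2 * K p := setLIntegral_le_lintegral _ _
    _ = 2 * ∫⁻ θ, ∫⁻ φ, K (θ, φ) := by
        rw [lintegral_const_mul' _ _ (by simp), hprod]
    _ ≤ 2 * ENNReal.ofReal (16 * ρ) := by gcongr
    _ = _ := by
        rw [show (2 : ℝ≥0∞) = ENNReal.ofReal 2 by simp, ← ENNReal.ofReal_mul (by norm_num)]
        congr 1; ring

/-! ### Regularity of the extension and positivity of the optimal constant -/

theorem eLpNorm_two_sq {α : Type*} [MeasurableSpace α] {μ : Measure α} (f : α → ℂ) :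
    eLpNorm f 2 μ ^ 2 = ∫⁻ x, ‖f x‖ₑ ^ 2 ∂μ := by
  simpa using eLpNorm_nnreal_pow_eq_lintegral (f := f) (μ := μ) (p := 2) (by norm_num)

theorem eLpNorm_six_pow {α : Type*} [MeasurableSpace α] {μ : Measure α} (f : α → ℂ) :
    eLpNorm f 6 μ ^ 6 = ∫⁻ x, ‖f x‖ₑ ^ 6 ∂μ := by
  simpa using eLpNorm_nnreal_pow_eq_lintegral (f := f) (μ := μ) (p := 6) (by norm_num)

theorem continuous_arcExtension {α : ℝ} {w : ℝ → ℂ}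
    (hw : IntegrableOn w (Set.Ioo α (α + Real.pi / 2))) : Continuous (arcExtension α w) := by
  unfold arcExtension
  refine continuous_of_dominated (bound := fun θ => ‖w θ‖) (fun ξ => ?_) (fun ξ => ?_) hw.norm ?_
  · refine AEStronglyMeasurable.mul (Continuous.aestronglyMeasurable ?_) hw.aestronglyMeasurable
    have := continuous_subtype_val.comp continuous_circlePoint
    exact Complex.continuous_exp.comp (continuous_const.mul
      (Complex.continuous_ofReal.comp (continuous_const.inner this)))
  · refine Filter.Eventually.of_forall fun θ => ?_
    rw [norm_mul, norm_exp_neg_I_mul, one_mul]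
  · refine Filter.Eventually.of_forall fun θ => ?_
    exact (Complex.continuous_exp.comp (continuous_const.mul
      (Complex.continuous_ofReal.comp (continuous_id.inner continuous_const)))).mul continuous_const

theorem continuous_extension {f : S1 → ℂ} (hf : Integrable f σ) : Continuous (extension f) := by
  unfold extension
  refine continuous_of_dominated (bound := fun x => ‖f x‖) (fun ξ => ?_) (fun ξ => ?_) hf.norm ?_
  · refine AEStronglyMeasurable.mul (Continuous.aestronglyMeasurable ?_) hf.aestronglyMeasurable
    exact Complex.continuous_exp.comp (continuous_const.mul
      (Complex.continuous_ofReal.comp (continuous_const.inner continuous_subtype_val)))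
  · refine Filter.Eventually.of_forall fun θ => ?_
    rw [norm_mul, norm_exp_neg_I_mul, one_mul]
  · refine Filter.Eventually.of_forall fun θ => ?_
    exact (Complex.continuous_exp.comp (continuous_const.mul
      (Complex.continuous_ofReal.comp (continuous_id.inner continuous_const)))).mul continuous_const

theorem extension_congr_ae {f g : S1 → ℂ} (h : f =ᵐ[σ] g) : extension f = extension g := by
  ext ξ
  refine integral_congr_ae ?_
  filter_upwards [h] with x hx
  rw [hx]

theorem extension_const_mul (c : ℂ) (f : S1 → ℂ) :
    extension (fun x => c * f x) = fun ξ => c * extension f ξ := by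
  ext ξ
  unfold extension
  rw [← integral_const_mul]
  congr 1; ext x; ring

/-- A normalized constant has a continuous extension that is nonzero at the origin, hence nonzero in
`L^6`. -/
theorem optConst_ne_zero : optConst ≠ 0 := by
  intro h0
  have hne : σ ≠ 0 := by
    unfold σ
    exact Measure.toSphere_ne_zero _
  have hu0 : σ.real Set.univ ≠ 0 := by
    rw [Measure.real, ENNReal.toReal_ne_zero]
    exact ⟨by simpa using hne, measure_ne_top _ _⟩
  have hupos : 0 < σ.real Set.univ := lt_of_le_of_ne measureReal_nonneg hu0.symm
  set c : ℝ := (σ.real Set.univ) ^ (-(1 / 2) : ℝ) with hc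
  have hcpos : 0 < c := Real.rpow_pos_of_pos hupos _
  set f : S1 → ℂ := fun _ => (c : ℂ) with hf
  have hmem : MemLp f 2 σ := memLp_const _
  have hnorm : eLpNorm f 2 σ = 1 := by
    rw [hf, eLpNorm_const _ (by norm_num) hne, ← ENNReal.ofReal_toReal (measure_ne_top σ Set.univ),
      ← ofReal_norm, Complex.norm_real, Real.norm_of_nonneg hcpos.le,
      ENNReal.ofReal_rpow_of_nonneg ENNReal.toReal_nonneg (by simp), ← ENNReal.ofReal_mul hcpos.le]
    change ENNReal.ofReal (c * (σ.real Set.univ) ^ _) = 1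
    rw [hc, ← Real.rpow_add hupos]
    norm_num
  have hle : eLpNorm (extension f) 6 volume ≤ optConst := by
    unfold optConst
    exact le_iSup_of_le f (le_iSup_of_le hmem (le_iSup_of_le hnorm le_rfl))
  rw [h0] at hle
  have hcont : Continuous (extension f) := continuous_extension (hmem.integrable (by norm_num))
  have hz : extension f =ᵐ[volume] 0 :=
    (eLpNorm_eq_zero_iff hcont.aestronglyMeasurable (by norm_num)).mp (le_antisymm hle zero_le)
  have hz' : extension f = 0 := (hcont.ae_eq_iff_eq volume continuous_zero).mp hz
  have h1 : extension f 0 = (σ.real Set.univ : ℂ) * c := by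
    simp [extension, hf]
  rw [hz'] at h1
  have h2 : (σ.real Set.univ : ℂ) * c ≠ 0 :=
    mul_ne_zero (by exact_mod_cast hu0) (by exact_mod_cast hcpos.ne')
  exact h2 h1.symm

theorem lintegral_σ {F : S1 → ℝ≥0∞} (hF : Measurable F) :
    ∫⁻ x, F x ∂σ = ∫⁻ θ in Set.Ioo (-Real.pi) Real.pi, F (circlePoint θ) := by
  rw [σ_eq_map, lintegral_map hF continuous_circlePoint.measurable]

theorem extension_eq_sum_arcExtension {f : S1 → ℂ} (hfm : Measurable f) (hf : Integrable f σ) (ξ : Plane) :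
    extension f ξ = ∑ j ∈ Finset.range 4,
      arcExtension (-Real.pi + j * (Real.pi / 2)) (fun θ => f (circlePoint θ)) ξ := by
  have hpi := Real.pi_pos
  set G : ℝ → ℂ := fun θ =>
    Complex.exp (-Complex.I * ((inner ℝ ξ (circlePoint θ : Plane) : ℝ) : ℂ)) * f (circlePoint θ) with hG
  have hcont : Continuous fun θ : ℝ =>
      Complex.exp (-Complex.I * ((inner ℝ ξ (circlePoint θ : Plane) : ℝ) : ℂ)) := by
    have := continuous_subtype_val.comp continuous_circlePoint
    exact Complex.continuous_exp.comp (continuous_const.mul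
      (Complex.continuous_ofReal.comp (continuous_const.inner this)))
  have hfi : IntegrableOn (fun θ => f (circlePoint θ)) (Set.Ioo (-Real.pi) Real.pi) := by
    rw [σ_eq_map] at hf
    exact hf.comp_measurable continuous_circlePoint.measurable
  have hGi : IntegrableOn G (Set.Ioo (-Real.pi) Real.pi) :=
    Integrable.bdd_mul (c := 1) hfi hcont.aestronglyMeasurable
      (Filter.Eventually.of_forall fun θ => (norm_exp_neg_I_mul _).le)
  have h1 : extension f ξ = ∫ θ in (-Real.pi)..Real.pi, G θ := by
    rw [intervalIntegral.integral_of_le (by linarith), integral_Ioc_eq_integral_Ioo]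
    unfold extension
    rw [σ_eq_map, integral_map continuous_circlePoint.measurable.aemeasurable]
    refine AEStronglyMeasurable.mul (Continuous.aestronglyMeasurable ?_) hfm.aestronglyMeasurable
    exact Complex.continuous_exp.comp (continuous_const.mul
      (Complex.continuous_ofReal.comp (continuous_const.inner continuous_subtype_val)))
  set a : ℕ → ℝ := fun j => -Real.pi + j * (Real.pi / 2) with ha
  have h2 : ∀ j, arcExtension (a j) (fun θ => f (circlePoint θ)) ξ = ∫ θ in (a j)..(a (j + 1)), G θ := by
    intro j
    have haj : a (j + 1) = a j + Real.pi / 2 := by simp only [ha]; push_cast; ring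
    rw [haj, intervalIntegral.integral_of_le (by linarith), integral_Ioc_eq_integral_Ioo]
    rfl
  have hint : ∀ j < 4, IntervalIntegrable G volume (a j) (a (j + 1)) := by
    intro j hj
    have hj' : (j : ℝ) ≤ 3 := by exact_mod_cast Nat.lt_succ_iff.mp hj
    have hj0 : (0 : ℝ) ≤ j := Nat.cast_nonneg j
    have haj : a (j + 1) = a j + Real.pi / 2 := by simp only [ha]; push_cast; ring
    rw [intervalIntegrable_iff_integrableOn_Ioo_of_le (by linarith)]
    apply hGi.mono_set
    apply Set.Ioo_subset_Ioo
    · simp only [ha]; nlinarith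
    · rw [haj]; simp only [ha]; nlinarith
  rw [h1]
  have h3 := intervalIntegral.sum_integral_adjacent_intervals hint
  have e0 : a 0 = -Real.pi := by simp [ha]
  have e4 : a 4 = Real.pi := by simp only [ha]; push_cast; ring
  rw [e0, e4] at h3
  rw [← h3]
  exact Finset.sum_congr rfl fun j _ => (h2 j).symm

/-! ### Extraction of the concentrating cap -/

/-- Otherwise each of the four quarter arcs contributes at most `τ` in `L^6`, for a total of at most
`4τ < 8τ`. -/
theorem exists_arc_concentration {f : S1 → ℂ} (hfm : Measurable f)
    (hf : ∫⁻ x, ‖f x‖ₑ ^ 2 ∂σ ≤ 1) {τ ρ : ℝ} (hτ : 0 < τ) (hρτ : ρ = τ ^ 3 / 4000)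
    (hbig : ENNReal.ofReal (8 * τ) ≤ eLpNorm (extension f) 6 volume) :
    ∃ α : ℝ, -Real.pi ≤ α ∧ α + Real.pi / 2 ≤ Real.pi ∧
      ∃ θ ∈ Set.Ioo α (α + Real.pi / 2), f (circlePoint θ) ≠ 0 ∧
      ENNReal.ofReal (ρ ^ 8) < ∫⁻ φ in Set.Ioo α (α + Real.pi / 2) ∩
        {φ | |φ - θ| < (ρ ^ 4)⁻¹ / ‖f (circlePoint θ)‖ ^ 2 ∧
          ‖f (circlePoint φ)‖ ≤ ‖f (circlePoint θ)‖}, ‖f (circlePoint φ)‖ₑ ^ 2 := by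
  have hpi := Real.pi_pos
  have hρ : 0 < ρ := by rw [hρτ]; positivity
  by_contra hcon
  push Not at hcon
  set w : ℝ → ℂ := fun θ => f (circlePoint θ) with hw
  have hwm : Measurable w := hfm.comp continuous_circlePoint.measurable
  have hfi : Integrable f σ := by
    have h2 : MemLp f 2 σ := by
      refine ⟨hfm.aestronglyMeasurable, ?_⟩
      rw [← eLpNorm_two_sq] at hf
      by_contra hc
      rw [not_lt, top_le_iff] at hc
      simp [hc] at hf
    exact h2.integrable (by norm_num)
  have hw1 : ∫⁻ θ in Set.Ioo (-Real.pi) Real.pi, ‖w θ‖ₑ ^ 2 ≤ 1 := by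
    rw [lintegral_σ (by fun_prop)] at hf
    exact hf
  have hwi : IntegrableOn w (Set.Ioo (-Real.pi) Real.pi) := by
    rw [σ_eq_map] at hfi
    exact hfi.comp_measurable continuous_circlePoint.measurable
  set a : ℕ → ℝ := fun j => -Real.pi + j * (Real.pi / 2) with ha
  have hj : ∀ j ∈ Finset.range 4, -Real.pi ≤ a j ∧ a j + Real.pi / 2 ≤ Real.pi := by
    intro j hj
    have hj' : (j : ℝ) ≤ 3 := by exact_mod_cast Nat.lt_succ_iff.mp (Finset.mem_range.mp hj)
    have hj0 : (0 : ℝ) ≤ j := Nat.cast_nonneg j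
    simp only [ha]
    constructor <;> nlinarith
  have hsub : ∀ j ∈ Finset.range 4, Set.Ioo (a j) (a j + Real.pi / 2) ⊆ Set.Ioo (-Real.pi) Real.pi :=
    fun j h => Set.Ioo_subset_Ioo (hj j h).1 (hj j h).2
  have hsmall : ∀ j ∈ Finset.range 4, eLpNorm (arcExtension (a j) w) 6 volume ≤ ENNReal.ofReal τ := by
    intro j h
    have h1 := lintegral_enorm_arcExtension_le_of_not_concentrated (α := a j) hwm
      ((lintegral_mono_set (hsub j h)).trans hw1) hρ (hcon (a j) (hj j h).1 (hj j h).2)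
    rw [← eLpNorm_six_pow] at h1
    -- This fixes the `4000` in `ρ`: with `π² ≤ 16` the left side is about `0.79 τ^6`.
    have h2 : 768 * Real.pi ^ 2 * (32 * ρ) ^ 2 ≤ τ ^ 6 := by
      rw [hρτ]
      have h3 : Real.pi ^ 2 ≤ 16 := by nlinarith [Real.pi_lt_four]
      have h4 : 0 < τ ^ 6 := by positivity
      calc _ = Real.pi ^ 2 * (768 * 1024 / 16000000 * τ ^ 6) := by ring
        _ ≤ 16 * (768 * 1024 / 16000000 * τ ^ 6) := by gcongr
        _ ≤ _ := by linarith
    have h5 := h1.trans (ENNReal.ofReal_le_ofReal h2)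
    rw [ENNReal.ofReal_pow hτ.le] at h5
    exact (ENNReal.pow_le_pow_left_iff (by norm_num)).mp h5
  have hsum : eLpNorm (extension f) 6 volume ≤ ENNReal.ofReal (4 * τ) := by
    have he : extension f = ∑ j ∈ Finset.range 4, arcExtension (a j) w := by
      ext ξ
      rw [extension_eq_sum_arcExtension hfm hfi, Finset.sum_apply]
    rw [he]
    refine (eLpNorm_sum_le (fun j h => (continuous_arcExtension
      (hwi.mono_set (hsub j h))).aestronglyMeasurable) (by norm_num)).trans ?_
    refine (Finset.sum_le_sum hsmall).trans (le_of_eq ?_)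
    rw [Finset.sum_const, Finset.card_range, nsmul_eq_mul, ENNReal.ofReal_mul (by norm_num)]
    simp
  have := hbig.trans hsum
  rw [ENNReal.ofReal_le_ofReal_iff (by positivity)] at this
  linarith

theorem exists_cap_concentration {f : S1 → ℂ} (hfm : Measurable f)
    (hf : ∫⁻ x, ‖f x‖ₑ ^ 2 ∂σ ≤ 1) {τ ρ : ℝ} (hτ : 0 < τ) (hρτ : ρ = τ ^ 3 / 4000)
    (hbig : ENNReal.ofReal (8 * τ) ≤ eLpNorm (extension f) 6 volume) :
    ∃ (z : S1) (r a : ℝ), 0 < r ∧ r ≤ 1 ∧ 0 < a ∧ σ.real (cap z r) * a ^ 2 ≤ 12 * (ρ ^ 4)⁻¹ ∧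
      ENNReal.ofReal (ρ ^ 8) < ∫⁻ x in cap z r ∩ {x | ‖f x‖ ≤ a}, ‖f x‖ₑ ^ 2 ∂σ := by
  obtain ⟨α, hα1, hα2, θ, hθ, hfθ, hlt⟩ := exists_arc_concentration hfm hf hτ hρτ hbig
  have hρ : 0 < ρ := by rw [hρτ]; positivity
  set a := ‖f (circlePoint θ)‖ with ha
  have hapos : 0 < a := norm_pos_iff.mpr hfθ
  set S := (ρ ^ 4)⁻¹ / a ^ 2 with hS
  have hSpos : 0 < S := by positivity
  have hr : 0 < min S 1 := lt_min hSpos one_pos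
  refine ⟨circlePoint θ, min S 1, a, hr, min_le_right _ _, hapos, ?_, ?_⟩
  · have h1 := σ_real_cap_le (θ := θ) ⟨by linarith [hθ.1], by linarith [hθ.2]⟩ hr
    have h2 : σ.real (cap (circlePoint θ) (min S 1)) ≤ 12 * S :=
      h1.trans (by gcongr; exact min_le_left _ _)
    calc _ ≤ 12 * S * a ^ 2 := by gcongr
      _ = _ := by rw [hS]; field_simp
  · refine lt_of_lt_of_le hlt ?_
    set E := cap (circlePoint θ) (min S 1) ∩ {x | ‖f x‖ ≤ a} with hE
    have hEm : MeasurableSet E :=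
      (measurableSet_cap _ _).inter (measurableSet_le hfm.norm measurable_const)
    rw [← lintegral_indicator hEm, lintegral_σ (Measurable.indicator (by fun_prop) hEm)]
    have h3 : ∀ φ, E.indicator (fun x => ‖f x‖ₑ ^ 2) (circlePoint φ) =
        (circlePoint ⁻¹' E).indicator (fun φ => ‖f (circlePoint φ)‖ₑ ^ 2) φ := fun φ => rfl
    simp_rw [h3]
    rw [setLIntegral_indicator (continuous_circlePoint.measurable hEm)]
    apply lintegral_mono_set
    rintro φ ⟨hφ, h4, h5⟩
    refine ⟨⟨circlePoint_mem_cap_of_abs_lt h4 ?_, h5⟩, ?_⟩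
    · rw [abs_lt]
      constructor <;> linarith [hφ.1, hφ.2, hθ.1, hθ.2]
    · exact ⟨by linarith [hφ.1], by linarith [hφ.2]⟩

/-- The minimum with `1` yields a real constant even though finiteness of the supremum is not known
here. -/
theorem exists_pos_ofReal_le_optConst : ∃ c : ℝ, 0 < c ∧ ENNReal.ofReal c ≤ optConst := by
  have h1 : min optConst 1 ≠ ⊤ := ne_top_of_le_ne_top ENNReal.one_ne_top (min_le_right _ _)
  have h0 : min optConst 1 ≠ 0 := by
    have h2 : 0 < min optConst 1 := lt_min (pos_iff_ne_zero.mpr optConst_ne_zero) one_pos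
    exact h2.ne'
  exact ⟨(min optConst 1).toReal, ENNReal.toReal_pos h0 h1, by
    rw [ENNReal.ofReal_toReal h1]; exact min_le_left _ _⟩

theorem exists_cap_concentration_of_memLp {f : S1 → ℂ} (hf : MemLp f 2 σ)
    (h0 : eLpNorm f 2 σ ≠ 0) {τ ρ : ℝ} (hτ : 0 < τ) (hρτ : ρ = τ ^ 3 / 4000)
    (hbig : ENNReal.ofReal (8 * τ) * eLpNorm f 2 σ ≤ eLpNorm (extension f) 6 volume) :
    ∃ (z : S1) (r : ℝ) (E : Set S1), 0 < r ∧ r ≤ 1 ∧ NullMeasurableSet E σ ∧ E ⊆ cap z r ∧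
      (∀ x ∈ E, ‖f x‖ ≤ 4 / ρ ^ 2 * (eLpNorm f 2 σ).toReal *
        (σ.real (cap z r)) ^ (-(1 / 2) : ℝ)) ∧
      ENNReal.ofReal (ρ ^ 4) * eLpNorm f 2 σ ≤ eLpNorm (E.indicator f) 2 σ := by
  have hρ : 0 < ρ := by rw [hρτ]; positivity
  have htop : eLpNorm f 2 σ ≠ ⊤ := hf.2.ne
  set N := (eLpNorm f 2 σ).toReal with hN
  have hNpos : 0 < N := ENNReal.toReal_pos h0 htop
  have hNe : eLpNorm f 2 σ = ENNReal.ofReal N := (ENNReal.ofReal_toReal htop).symm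
  obtain ⟨f', hf'sm, hff'⟩ := hf.1
  have hf'm : Measurable f' := hf'sm.measurable
  set F : S1 → ℂ := fun x => ((N⁻¹ : ℝ) : ℂ) * f' x with hF
  have hFm : Measurable F := by simp only [hF]; fun_prop
  have hNinv : ‖((N⁻¹ : ℝ) : ℂ)‖ₑ = ENNReal.ofReal N⁻¹ := by
    rw [← ofReal_norm, Complex.norm_real, Real.norm_of_nonneg (by positivity)]
  have hNN : ENNReal.ofReal N⁻¹ * ENNReal.ofReal N = 1 := by
    rw [← ENNReal.ofReal_mul (by positivity), inv_mul_cancel₀ hNpos.ne', ENNReal.ofReal_one]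
  have hFnorm : ∫⁻ x, ‖F x‖ₑ ^ 2 ∂σ ≤ 1 := by
    rw [← eLpNorm_two_sq]
    have : eLpNorm F 2 σ = 1 := by
      change eLpNorm (((N⁻¹ : ℝ) : ℂ) • f') 2 σ = 1
      rw [eLpNorm_const_smul, hNinv, ← eLpNorm_congr_ae hff', hNe, hNN]
    rw [this, one_pow]
  have hFbig : ENNReal.ofReal (8 * τ) ≤ eLpNorm (extension F) 6 volume := by
    have h1 : extension F = ((N⁻¹ : ℝ) : ℂ) • extension f := by
      rw [extension_congr_ae hff']
      exact extension_const_mul _ _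
    rw [h1, eLpNorm_const_smul, hNinv]
    calc ENNReal.ofReal (8 * τ)
        = ENNReal.ofReal N⁻¹ * (ENNReal.ofReal (8 * τ) * eLpNorm f 2 σ) := by
          rw [hNe, mul_left_comm, hNN, mul_one]
      _ ≤ _ := by gcongr
  obtain ⟨z, r, a, hr, hr1, ha, hcap, hlt⟩ := exists_cap_concentration hFm hFnorm hτ hρτ hFbig
  set E₀ : Set S1 := cap z r ∩ {x | ‖F x‖ ≤ a} with hE₀
  have hE₀m : MeasurableSet E₀ :=
    (measurableSet_cap _ _).inter (measurableSet_le hFm.norm measurable_const)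
  -- Removing the null set where `f` differs from its measurable representative makes the height
  -- bound hold at every point for `f` itself; the price is that `E` is only null-measurable.
  set E : Set S1 := E₀ ∩ {x | f x = f' x} with hE
  have hEE₀ : E =ᵐ[σ] E₀ := by
    rw [Filter.eventuallyEq_set]
    filter_upwards [hff'] with x hx
    exact ⟨fun h => h.1, fun h => ⟨h, hx⟩⟩
  -- A null cap could not carry squared mass above `ρ^8`.
  have hcap0 : 0 < σ.real (cap z r) := by
    refine lt_of_le_of_ne measureReal_nonneg fun hc => ?_
    have hc0 : σ (cap z r) = 0 := by
      rcases (ENNReal.toReal_eq_zero_iff _).mp hc.symm with h | h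
      · exact h
      · exact absurd h (measure_ne_top _ _)
    have hE0 : σ E₀ = 0 := measure_mono_null Set.inter_subset_left hc0
    rw [Measure.restrict_eq_zero.mpr hE0] at hlt
    simp at hlt
  have haC : a ≤ 4 / ρ ^ 2 * (σ.real (cap z r)) ^ (-(1 / 2) : ℝ) := by
    have h1 : (σ.real (cap z r)) ^ (-(1 / 2) : ℝ) = (Real.sqrt (σ.real (cap z r)))⁻¹ := by
      rw [Real.rpow_neg hcap0.le, Real.sqrt_eq_rpow]
    have hs : 0 < Real.sqrt (σ.real (cap z r)) := Real.sqrt_pos.mpr hcap0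
    rw [h1, ← div_eq_mul_inv, le_div_iff₀ hs]
    refine (pow_le_pow_iff_left₀ (by positivity) (by positivity) two_ne_zero).mp ?_
    rw [mul_pow, Real.sq_sqrt hcap0.le, mul_comm]
    -- The `4` in the height bound comes from `12 ≤ 4^2`.
    refine hcap.trans ?_
    rw [div_pow, ← pow_mul, div_eq_mul_inv]
    gcongr
    norm_num
  refine ⟨z, r, E, hr, hr1, hE₀m.nullMeasurableSet.congr hEE₀.symm,
    fun x hx => hx.1.1, ?_, ?_⟩
  · rintro x ⟨⟨_, hx⟩, hfx⟩
    have hfx' : f x = f' x := hfx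
    have hFx : ‖F x‖ = N⁻¹ * ‖f x‖ := by
      simp only [hF]
      rw [norm_mul, Complex.norm_real, Real.norm_of_nonneg (by positivity), hfx']
    have hx' : ‖F x‖ ≤ a := hx
    rw [hFx, inv_mul_le_iff₀ hNpos] at hx'
    calc ‖f x‖ ≤ N * a := hx'
      _ ≤ N * (4 / ρ ^ 2 * (σ.real (cap z r)) ^ (-(1 / 2) : ℝ)) := by gcongr
      _ = _ := by ring
  · have h1 : E.indicator f =ᵐ[σ] E₀.indicator f' := by
      filter_upwards [hff', Filter.eventuallyEq_set.mp hEE₀] with x hx hx2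
      by_cases h : x ∈ E₀
      · rw [Set.indicator_of_mem h, Set.indicator_of_mem (hx2.mpr h), hx]
      · rw [Set.indicator_of_notMem h, Set.indicator_of_notMem (fun hc => h (hx2.mp hc))]
    have h2 : E₀.indicator F = ((N⁻¹ : ℝ) : ℂ) • E₀.indicator f' := by
      ext x
      by_cases h : x ∈ E₀ <;> simp [h, hF]
    have h3 : ENNReal.ofReal (ρ ^ 4) ≤ eLpNorm (E₀.indicator F) 2 σ := by
      refine (ENNReal.pow_le_pow_left_iff two_ne_zero).mp ?_
      rw [eLpNorm_two_sq, ← ENNReal.ofReal_pow (by positivity), ← pow_mul]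
      refine hlt.le.trans (le_of_eq ?_)
      rw [← lintegral_indicator hE₀m]
      congr 1; ext x
      by_cases h : x ∈ E₀ <;> simp [h]
    rw [h2, eLpNorm_const_smul, hNinv] at h3
    rw [eLpNorm_congr_ae h1, hNe]
    calc _ ≤ ENNReal.ofReal N⁻¹ * eLpNorm (E₀.indicator f') 2 σ * ENNReal.ofReal N := by gcongr
      _ = ENNReal.ofReal N⁻¹ * ENNReal.ofReal N * eLpNorm (E₀.indicator f') 2 σ := by ring
      _ = _ := by rw [hNN, one_mul]

end CircleExtension

/-! ### The decomposition and its constants -/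

theorem proposition2p7 :
    ∃ C η : ℝ → ℝ,
      (∃ κ : ℝ, 0 < κ ∧ ∃ a : ℕ, ∀ δ : ℝ, 0 < δ → (C δ)⁻¹ = κ * δ ^ a) ∧
      (∃ κ : ℝ, 0 < κ ∧ ∃ b : ℕ, ∀ δ : ℝ, 0 < δ → η δ = κ * δ ^ b) ∧
      ∀ δ : ℝ, 0 < δ → ∀ f : CircleExtension.S1 → ℂ, MemLp f 2 CircleExtension.σ →
        ENNReal.ofReal δ * CircleExtension.optConst * eLpNorm f 2 CircleExtension.σ ≤
          eLpNorm (CircleExtension.extension f) 6 volume →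
        ∃ g h : CircleExtension.S1 → ℂ, ∃ z : CircleExtension.S1, ∃ r : ℝ,
          0 < r ∧ r ≤ 1 ∧
          MemLp g 2 CircleExtension.σ ∧ MemLp h 2 CircleExtension.σ ∧
          (∀ x, f x = g x + h x) ∧
          (∀ x, ‖g x‖ ≤ ‖f x‖ ∧ ‖h x‖ ≤ ‖f x‖) ∧
          Disjoint (Function.support g) (Function.support h) ∧
          (∀ x, ‖g x‖ ≤ C δ * (eLpNorm f 2 CircleExtension.σ).toReal *
            (CircleExtension.σ.real (CircleExtension.cap z r)) ^ (-(1 / 2) : ℝ) *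
            (CircleExtension.cap z r).indicator (fun _ => (1 : ℝ)) x) ∧
          ENNReal.ofReal (η δ) * eLpNorm f 2 CircleExtension.σ ≤
            eLpNorm g 2 CircleExtension.σ ∧
          ((∀ᵐ x ∂CircleExtension.σ, 0 ≤ f x) →
            ∀ᵐ x ∂CircleExtension.σ, 0 ≤ g x ∧ 0 ≤ h x) := by
  obtain ⟨c, hc, hcopt⟩ := CircleExtension.exists_pos_ofReal_le_optConst
  set κ : ℝ := (c / 8) ^ 3 / 4000 with hκ
  have hκpos : 0 < κ := by positivity
  -- With `τ = δ c / 8` one has `ρ = κ δ^3`; the bounds `4 / ρ^2` and `ρ^4` then give the exponents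
  -- `6` and `12`.
  refine ⟨fun δ => 4 / (κ * δ ^ 3) ^ 2, fun δ => (κ * δ ^ 3) ^ 4,
    ⟨κ ^ 2 / 4, by positivity, 6, fun δ _ => ?_⟩, ⟨κ ^ 4, by positivity, 12, fun δ _ => ?_⟩, ?_⟩
  · rw [inv_div]; ring
  · ring
  intro δ hδ f hf hbig
  -- Normalization is impossible for a null `f`; there `g = 0` and an arbitrary cap suffice.
  by_cases h0 : eLpNorm f 2 CircleExtension.σ = 0
  · refine ⟨0, f, CircleExtension.circlePoint 0, 1, one_pos, le_rfl, MemLp.zero, hf,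
      fun x => by simp, fun x => by simp, by simp, fun x => ?_, by simp [h0], fun h => ?_⟩
    · simp [h0]
    · filter_upwards [h] with x hx
      exact ⟨le_rfl, hx⟩
  obtain ⟨z, r, E, hr, hr1, hE, hsub, hbound, hmass⟩ :=
    CircleExtension.exists_cap_concentration_of_memLp hf h0 (τ := δ * c / 8) (ρ := κ * δ ^ 3)
      (by positivity) (by rw [hκ]; ring) (by
        refine le_trans ?_ hbig
        gcongr
        rw [show 8 * (δ * c / 8) = δ * c by ring, ENNReal.ofReal_mul hδ.le]
        gcongr)
  have hdecomp : ∀ x, f x = E.indicator f x + Eᶜ.indicator f x := fun x =>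
    (congrFun (Set.indicator_self_add_compl E f) x).symm
  have hg : MemLp (E.indicator f) 2 CircleExtension.σ :=
    ⟨hf.1.indicator₀ hE, (eLpNorm_indicator_le f).trans_lt hf.2⟩
  have hh : MemLp (Eᶜ.indicator f) 2 CircleExtension.σ :=
    ⟨hf.1.indicator₀ hE.compl, (eLpNorm_indicator_le f).trans_lt hf.2⟩
  refine ⟨E.indicator f, Eᶜ.indicator f, z, r, hr, hr1, hg, hh, hdecomp,
    fun x => ⟨norm_indicator_le_norm_self _ _, norm_indicator_le_norm_self _ _⟩, ?_, ?_, hmass, ?_⟩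
  · exact disjoint_compl_right.mono Set.support_indicator_subset Set.support_indicator_subset
  · intro x
    by_cases hx : x ∈ E
    · rw [Set.indicator_of_mem hx, Set.indicator_of_mem (hsub hx), mul_one]
      exact hbound x hx
    · rw [Set.indicator_of_notMem hx, norm_zero]
      exact mul_nonneg (by positivity) (Set.indicator_nonneg (fun _ _ => zero_le_one) _)
  · intro h
    filter_upwards [h] with x hx
    exact ⟨Set.indicator_apply_nonneg fun _ => hx, Set.indicator_apply_nonneg fun _ => hx⟩
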